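/- **Setting.** A multi-sender unicast index-coding problem has $N$ independent messages $M_1,\dots,M_N$, $K$ senders, sender $k$ knowing the messages indexed by $\mathcal S_k\subseteq[1:N]$ and having a noiseless broadcast link of capacity $C_k>0$, and $N$ receivers, receiver $j$ knowing the messages indexed by $\mathcal A_j\not\ni j$ and requesting $M_j$. For $R\in\mathbb R_+^N$, a code of block length $n$ has message alphabets of size $2^{\lceil nR_j\rceil}$, encoders mapping the messages $(M_i)_{i\in\mathcal S_k}$ to an index from a set of size $2^{\lfloor nC_k\rfloor}$, and decoders mapping all $K$ indices and $(M_i)_{i\in\mathcal A_j}$ to an estimate of $M_j$. The tuple $R$ is achievable if some sequence of such codes has average error probability (uniform messages; an error occurs if any receiver errs) tending to $0$ as $n\to\infty$. The capacity region $\mathcal C$ is the closure of the set of achievable tuples. The side-information digraph $G$ on $[1:N]$ has an arc $i\to j$ iff $j\in\mathcal A_i$. The MAIS outer bound $\mathcal R_{\rm out}$ is the set of $R\in\mathbb R^N_+$ with $\sum_{j\in S}R_j\le\sum_{k:\,\mathcal S_k\cap S\neq\emptyset}C_k$ for every $S\subseteq[1:N]$ that induces an acyclic subgraph of $G$. **Composite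 coding.** For a nonempty group $P\subseteq[1:K]$ of senders let $\mathcal S_P=\bigcup_{k\in P}\mathcal S_k$, $\mathcal A_{j,P}=\mathcal A_j\cap\mathcal S_P$, and for $Q\subseteq[1:K]$ let $\mathcal I_Q=\bigcup_{k\in Q}\{J:J\subseteq \mathcal S_k\}$. A decoding choice for $P$ is a family $D=(D_j)_{j\in \mathcal S_P}$ with $j\in D_j\subseteq\mathcal S_P\setminus\mathcal A_{j,P}$. *Cooperative (CCC).* $\mathcal R^{\rm co}_P$ is the union, over all decoding choices $D$, of the sets of $(r_j)_{j\in\mathcal S_P}\ge 0$ for which there are $\gamma_J\ge0$ ($J\in\mathcal I_P$) with $$\sum_{i\in T}r_i<\sum_{J\in\mathcal I_P:\,J\subseteq D_j\cup\mathcal A_{j,P},\,J\cap T\ne\emptyset}\gamma_J\qquad(j\in\mathcal S_P,\ \emptyset\ne T\subseteq D_j),$$ $$\sum_{J\in\mathcal I_Q\setminus\mathcal I_{P\setminus Q}:\,J\not\subseteq\mathcal A_{j,P}}\gamma_J<\sum_{k\in Q}C_k\qquad(j\in\mathcal S_P,\ \emptyset\neq Q\subseteq P).$$ *Non-cooperative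 (partitioned DCC).* $\mathcal R^{\rm nc}_P$ is the union, over all decoding choices $D$, of the sets of $(r_j)_{j\in\mathcal S_P}\ge0$ for which there are $\gamma^{(k)}_J\ge0$ ($k\in P$, $J\subseteq\mathcal S_k$) with $$\sum_{i\in T}r_i<\sum_{J\subseteq D_j\cup\mathcal A_{j,P},\,J\cap T\neq\emptyset}\ \sum_{k\in P:\,J\subseteq\mathcal S_k}\gamma^{(k)}_J\qquad(j\in\mathcal S_P,\ \emptyset\ne T\subseteq D_j),$$ $$\sum_{J\subseteq\mathcal S_k:\,J\not\subseteq\mathcal A_{j,P}}\gamma_J^{(k)}<C_k\qquad(j\in\mathcal S_P,\ k\in P).$$ For a partition $\Pi$ of $[1:K]$ into nonempty groups, $\mathcal R^{\rm co}(\Pi)$ is the set of $R$ of the form $R_j=\sum_{P\in\Pi:\,j\in\mathcal S_P}R_{j,P}$ with $(R_{j,P})_{j\in\mathcal S_P}\in\mathcal R^{\rm co}_P$ for all $P\in\Pi$; $\mathcal R^{\rm nc}(\Pi)$ is defined likewise. Put $$\mathcal R_{\rm C}=\operatorname{conv}\mathcal R^{\rm co}(\{[1:K]\}),\qquad \mathcal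 R_{\rm CS}=\operatorname{conv}\bigcup_\Pi\mathcal R^{\rm co}(\Pi),\qquad \mathcal R_{\rm S}=\operatorname{conv}\bigcup_\Pi\mathcal R^{\rm nc}(\Pi).$$ **Result.** Consider the instance with $K=4$, $N=5$, $\mathcal S_1=\{1,2,3\}$, $\mathcal S_2=\{2,3,4\}$, $\mathcal S_3=\{1,2\}$, $\mathcal S_4=\{2,4,5\}$, $C_1=C_2=C_3=C_4=1$, and $\mathcal A_1=\{4,5\}$, $\mathcal A_2=\{1,3,5\}$, $\mathcal A_3=\{1,2\}$, $\mathcal A_4=\{2,3,5\}$, $\mathcal A_5=\{3\}$. Let $\mathcal R^*$ be the set of $(R_1,\dots,R_5)\in\mathbb R_+^5$ with $$R_1<2,\quad R_3<2,\quad R_5<1,\quad R_1+R_3<3,\quad R_4+R_5<2,$$ $$R_1+R_2+R_5<4,\quad R_2+R_4+R_5<4,\quad R_3+R_4+R_5<3.$$ Then: 1. $\mathcal R^{\rm co}(\{\{1,2\},\{3,4\}\})=\mathcal R^*$ and $\mathcal R_{\rm CS}=\mathcal R^*$. 2. Every tuple of $\mathcal R^*$ is achievable, and $\overline{\mathcal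 R^*}=\mathcal R_{\rm out}=\mathcal C$. 3. $\mathcal R_{\rm C}\subsetneq\mathcal R_{\rm CS}$, and moreover $\overline{\mathcal R_{\rm C}}\neq\mathcal C$. 4. $\mathcal R_{\rm S}\subsetneq\mathcal R_{\rm CS}$. -/

import Mathlib

open Filter Topology

noncomputable section

/-- A multi-sender unicast index-coding problem with `N` independent messages, `N` receivers
(receiver `j` requests message `j`) and `K` senders, indexed by `Fin N` and `Fin K`.
Sender `k` knows the messages in `S k` and has a noiseless broadcast link of capacity `C k`
(bits per channel use); receiver `j` knows the messages in `A j` beforehand. -/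
structure IndexProblem (N K : ℕ) where
  S : Fin K → Finset (Fin N)
  A : Fin N → Finset (Fin N)
  C : Fin K → ℝ
  distinct : Function.Injective S
  covers : ∀ j, ∃ k, j ∈ S k
  notMem_side : ∀ j, j ∉ A j
  C_pos : ∀ k, 0 < C k

namespace IndexProblem

variable {N K : ℕ} (I : IndexProblem N K)

/-! ### Index codes and the capacity region -/

/-- The message alphabet `[1 : 2 ^ (n R)]`, which has `2 ^ ⌈n R⌉` elements. -/
abbrev Msg (n : ℕ) (r : ℝ) : Type := Fin (2 ^ ⌈(n : ℝ) * r⌉₊)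

/-- The link alphabet `[1 : 2 ^ (n C))`, which has `2 ^ ⌊n C⌋` elements. -/
abbrev Link (n : ℕ) (c : ℝ) : Type := Fin (2 ^ ⌊(n : ℝ) * c⌋₊)

/-- A multi-sender index code of block length `n` for the rate tuple `R`. -/
structure Code (R : Fin N → ℝ) (n : ℕ) where
  enc : ∀ k : Fin K, (∀ i : {i // i ∈ I.S k}, Msg n (R i)) → Link n (I.C k)
  dec : ∀ j : Fin N, (∀ k : Fin K, Link n (I.C k)) →
    (∀ i : {i // i ∈ I.A j}, Msg n (R i)) → Msg n (R j)

variable {I} in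
/-- The estimate of message `j` at receiver `j` when the message tuple is `m`. -/
def Code.estimate {R : Fin N → ℝ} {n : ℕ} (c : I.Code R n) (m : ∀ j, Msg n (R j))
    (j : Fin N) : Msg n (R j) :=
  c.dec j (fun k => c.enc k fun i => m i) (fun i => m i)

variable {I} in
/-- The average probability of error for independent, uniformly distributed messages, that is,
for a message tuple that is uniform on the product of the message alphabets. -/
def Code.errorProb {R : Fin N → ℝ} {n : ℕ} (c : I.Code R n) : ℝ :=
  (Nat.card {m : ∀ j, Msg n (R j) // (fun j => c.estimate m j) ≠ m} : ℝ) /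
    (Nat.card (∀ j, Msg n (R j)) : ℝ)

/-- A rate tuple is achievable if a sequence of codes, one for each block length, has
vanishing average probability of error. -/
def Achievable (R : Fin N → ℝ) : Prop :=
  (∀ j, 0 ≤ R j) ∧
    ∃ c : ∀ n : ℕ, I.Code R n, Tendsto (fun n => (c n).errorProb) atTop (𝓝 0)

/-- The capacity region: the closure of the set of achievable rate tuples. -/
def capacityRegion : Set (Fin N → ℝ) := closure {R | I.Achievable R}

/-! ### The maximal-acyclic-induced-subgraph (MAIS) outer bound -/

/-- The side-information digraph: an arc from `i` to `j` iff receiver `i` knows message `j`. -/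
def sideInfoGraph : Digraph (Fin N) where
  Adj i j := j ∈ I.A i

/-- The subgraph of the side-information digraph induced by `T` has no directed cycle. -/
def InducedAcyclic (T : Finset (Fin N)) : Prop :=
  ∀ v, ¬ Relation.TransGen (fun i j => i ∈ T ∧ j ∈ T ∧ I.sideInfoGraph.Adj i j) v v

/-- The region described by the MAIS outer bound. -/
def maisRegion : Set (Fin N → ℝ) :=
  {R | (∀ j, 0 ≤ R j) ∧ ∀ T : Finset (Fin N), I.InducedAcyclic T →
    ∑ j ∈ T, R j ≤ ∑ k with (I.S k ∩ T).Nonempty, I.C k}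

/-! ### Notions common to the coding schemes -/

/-- `S_P`: the messages available at the senders of the group `P`. -/
def groupMsgs (P : Finset (Fin K)) : Finset (Fin N) := P.biUnion I.S

/-- `A_{j,P}`: the side information of receiver `j` within the group `P`. -/
def groupSide (P : Finset (Fin K)) (j : Fin N) : Finset (Fin N) := I.A j ∩ I.groupMsgs P

/-- A decoding choice for the group `P`: receiver `j`, for `j ∈ S_P`, decodes the messages in
`D j`, where `j ∈ D j ⊆ S_P \ A_{j,P}`. -/
def IsDecodingChoice (P : Finset (Fin K)) (D : Fin N → Finset (Fin N)) : Prop :=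
  ∀ j ∈ I.groupMsgs P, j ∈ D j ∧ D j ⊆ I.groupMsgs P \ I.groupSide P j

/-- `I_Q`: the index sets of the composite messages that some sender of `Q` can form. -/
def composites (Q : Finset (Fin K)) : Finset (Finset (Fin N)) :=
  Finset.univ.filter fun J => ∃ k ∈ Q, J ⊆ I.S k

/-- All rate tuples obtained by adding up, over the groups `P ∈ Π`, group rates taken from the
regions `G P`. A group rate tuple `r P` is a function on all messages, of which only the entries
in `S_P` are used. -/
def combine (Pi : Finset (Finset (Fin K))) (G : Finset (Fin K) → Set (Fin N → ℝ)) :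
    Set (Fin N → ℝ) :=
  {R | ∃ r : Finset (Fin K) → Fin N → ℝ, (∀ P ∈ Pi, r P ∈ G P) ∧
    ∀ j, R j = ∑ P ∈ Pi with j ∈ I.groupMsgs P, r P j}

/-! ### Cooperative composite coding (CCC) -/

/-- The CCC region of the group `P` with link capacities `c` for a fixed decoding choice `D`.
`γ J` is the rate of the common composite index of the composite message `J`. -/
def cccFixed (P : Finset (Fin K)) (c : Fin K → ℝ) (D : Fin N → Finset (Fin N)) :
    Set (Fin N → ℝ) :=
  {r | (∀ j ∈ I.groupMsgs P, 0 ≤ r j) ∧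
    ∃ γ : Finset (Fin N) → ℝ,
      (∀ J ∈ I.composites P, 0 ≤ γ J) ∧
      (∀ j ∈ I.groupMsgs P, ∀ T ⊆ D j, T.Nonempty →
        ∑ i ∈ T, r i <
          ∑ J ∈ I.composites P with J ⊆ D j ∪ I.groupSide P j ∧ (J ∩ T).Nonempty, γ J) ∧
      (∀ j ∈ I.groupMsgs P, ∀ Q ⊆ P, Q.Nonempty →
        ∑ J ∈ I.composites Q with J ∉ I.composites (P \ Q) ∧ ¬ J ⊆ I.groupSide P j, γ J <
          ∑ k ∈ Q, c k)}

/-- The CCC region of the group `P` with link capacities `c`. -/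
def cccGroup (P : Finset (Fin K)) (c : Fin K → ℝ) : Set (Fin N → ℝ) :=
  ⋃ (D : Fin N → Finset (Fin N)) (_ : I.IsDecodingChoice P D), I.cccFixed P c D

/-- The CCC region for a family `Pi` of sender groups in which every sender uses its whole link
capacity in its group. -/
def cccRegion (Pi : Finset (Finset (Fin K))) : Set (Fin N → ℝ) :=
  I.combine Pi fun P => I.cccGroup P I.C

/-- `R_C`: CCC with all senders in one group, followed by time sharing. -/
def RC : Set (Fin N → ℝ) := convexHull ℝ (I.cccRegion {Finset.univ})

/-- `R_CS`: CCC with sender partitioning, followed by time sharing. -/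
def RCS : Set (Fin N → ℝ) :=
  convexHull ℝ (⋃ Pi : Finpartition (Finset.univ : Finset (Fin K)), I.cccRegion Pi.parts)

/-! ### Partitioned distributed composite coding (DCC) -/

/-- The DCC region of the group `P` for a fixed decoding choice `D`.
`γ k J` is the rate of the composite index that sender `k` forms from the composite
message `J`. -/
def dccFixed (P : Finset (Fin K)) (D : Fin N → Finset (Fin N)) : Set (Fin N → ℝ) :=
  {r | (∀ j ∈ I.groupMsgs P, 0 ≤ r j) ∧
    ∃ γ : Fin K → Finset (Fin N) → ℝ,
      (∀ k ∈ P, ∀ J ⊆ I.S k, 0 ≤ γ k J) ∧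
      (∀ j ∈ I.groupMsgs P, ∀ T ⊆ D j, T.Nonempty →
        ∑ i ∈ T, r i <
          ∑ J : Finset (Fin N) with J ⊆ D j ∪ I.groupSide P j ∧ (J ∩ T).Nonempty,
            ∑ k ∈ P with J ⊆ I.S k, γ k J) ∧
      (∀ j ∈ I.groupMsgs P, ∀ k ∈ P,
        ∑ J ∈ (I.S k).powerset with ¬ J ⊆ I.groupSide P j, γ k J < I.C k)}

/-- The DCC region of the group `P`. -/
def dccGroup (P : Finset (Fin K)) : Set (Fin N → ℝ) :=
  ⋃ (D : Fin N → Finset (Fin N)) (_ : I.IsDecodingChoice P D), I.dccFixed P D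

/-- `R_S`: partitioned DCC, followed by time sharing. -/
def RS : Set (Fin N → ℝ) :=
  convexHull ℝ (⋃ Pi : Finpartition (Finset.univ : Finset (Fin K)),
    I.combine Pi.parts I.dccGroup)

end IndexProblem

/-! ### The 4-sender, 5-message instance

Messages `1, …, 5` and senders `1, …, 4` are numbered from `0` here. -/

/-- Senders `{1,2,3}`, `{2,3,4}`, `{1,2}`, `{2,4,5}` with unit links; side information
`{4,5}`, `{1,3,5}`, `{1,2}`, `{2,3,5}`, `{3}`. -/
def fourSenderProblem : IndexProblem 5 4 where
  S := ![{0, 1, 2}, {1, 2, 3}, {0, 1}, {1, 3, 4}]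
  A := ![{3, 4}, {0, 2, 4}, {0, 1}, {1, 2, 4}, {2}]
  C := fun _ => 1
  distinct := by decide
  covers := by decide
  notMem_side := by decide
  C_pos := fun _ => one_pos

/-- The sender partition `{{1,2},{3,4}}`. -/
def pairPartition : Finpartition (Finset.univ : Finset (Fin 4)) where
  parts := {{0, 1}, {2, 3}}
  supIndep := by
    rw [Finset.supIndep_iff_pairwiseDisjoint]
    intro a ha b hb hab
    simp only [Finset.coe_insert, Finset.coe_singleton, Set.mem_insert_iff,
      Set.mem_singleton_iff] at ha hb
    rcases ha with rfl | rfl <;> rcases hb with rfl | rfl <;>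
      first
        | exact absurd rfl hab
        | (simp only [Function.onFun, id]; decide)
  sup_parts := by decide
  bot_notMem := by decide

/-- The explicit rate region of the instance. -/
def fourSenderRegion : Set (Fin 5 → ℝ) :=
  {R | (∀ j, 0 ≤ R j) ∧
    R 0 < 2 ∧ R 2 < 2 ∧ R 4 < 1 ∧
    R 0 + R 2 < 3 ∧ R 3 + R 4 < 2 ∧
    R 0 + R 1 + R 4 < 4 ∧
    R 1 + R 3 + R 4 < 4 ∧
    R 2 + R 3 + R 4 < 3}

end

/-! Numbering starts at 0, as in the definition of the instance. The upper bounds come from acyclic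
sets: such a set contains a sink, a receiver that knows none of its messages. Peeling off sinks
shows that the rates of an acyclic set `T` must all pass through the links whose senders know a
message of `T`. For partitioned CCC this is `cccRegion_sum_lt`, for arbitrary codes
`Achievable.mem_maisRegion`. Eight acyclic sets produce exactly the inequalities of the explicit
region.

For the converse inclusions the senders work in the pairs `{0,1}` and `{2,3}`. `exists_timeSharing`
turns the eight inequalities into amounts of a few elementary transmission modes. Over the reals it
yields composite rates (`fourSenderRegion_subset_cccRegion`); over the integers it yields zero-error
codes built from parities (`hasBitCode_of_le`), so achievability needs no random coding. Scaling
towards the origin identifies the closure with the MAIS region.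

The two strict inclusions rest on linear-programming certificates. For each relevant shape of the
decoding sets, decoding inequalities are added and compared coefficient by coefficient with a sum of
link inequalities. A single group obeys `R 0 + R 1 + R 2 + R 3 < 6`, although the explicit region
comes arbitrarily close to 7. DCC obeys `3 * R 0 + 2 * R 1 + 2 * R 2 + 3 * R 3 ≤ 17` for every
partition, because each group is bounded by a quantity additive over its senders; the explicit
region comes arbitrarily close to 18. -/

namespace IndexProblem

variable {N K : ℕ} (I : IndexProblem N K)

/-! ### The MAIS bound for composite coding -/

variable {I} in
lemma InducedAcyclic.mono {T U : Finset (Fin N)} (h : I.InducedAcyclic T) (hUT : U ⊆ T) :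
    I.InducedAcyclic U := fun v hv =>
  h v (Relation.TransGen.mono (fun _ _ hr => ⟨hUT hr.1, hUT hr.2.1, hr.2.2⟩) _ _ hv)

variable {I} in
/-- A nonempty acyclic set contains a receiver that knows no message of the set. -/
lemma InducedAcyclic.exists_sink {T : Finset (Fin N)} (h : I.InducedAcyclic T)
    (hT : T.Nonempty) : ∃ j ∈ T, ∀ i ∈ T, i ∉ I.A j := by
  let r : Fin N → Fin N → Prop :=
    fun b a => Relation.TransGen (fun i j => i ∈ T ∧ j ∈ T ∧ I.sideInfoGraph.Adj i j) a b
  have : Std.Irrefl r := ⟨fun a ha => h a ha⟩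
  have : IsTrans (Fin N) r := ⟨fun a b c hab hbc => hbc.trans hab⟩
  have wf : WellFounded r := Finite.wellFounded_of_trans_of_irrefl r
  obtain ⟨j, hj, hmin⟩ := wf.has_min (T : Set (Fin N)) hT
  exact ⟨j, hj, fun i hi hij => hmin i hi (.single ⟨hj, hi, hij⟩)⟩

/-- The rates of an acyclic set are carried by the composite indices that touch the set. -/
lemma sum_le_sum_composites {P : Finset (Fin K)} {D : Fin N → Finset (Fin N)}
    (hD : I.IsDecodingChoice P D) {r : Fin N → ℝ} {γ : Finset (Fin N) → ℝ}
    (hγ : ∀ J ∈ I.composites P, 0 ≤ γ J)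
    (hdec : ∀ j ∈ I.groupMsgs P, ∀ T ⊆ D j, T.Nonempty →
        ∑ i ∈ T, r i <
          ∑ J ∈ I.composites P with J ⊆ D j ∪ I.groupSide P j ∧ (J ∩ T).Nonempty, γ J)
    (T : Finset (Fin N)) (hTP : T ⊆ I.groupMsgs P) (hT : I.InducedAcyclic T) :
    ∑ i ∈ T, r i ≤ ∑ J ∈ I.composites P with (J ∩ T).Nonempty, γ J := by
  induction T using Finset.strongInduction with
  | H T ih =>
  rcases T.eq_empty_or_nonempty with rfl | hne
  · simp
  obtain ⟨j, hj, hsink⟩ := hT.exists_sink hne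
  have hjD := (hD j (hTP hj)).1
  have hss : T \ D j ⊂ T :=
    (Finset.ssubset_iff_of_subset Finset.sdiff_subset).2 ⟨j, hj, by simp [hjD]⟩
  have h2 := ih _ hss (hss.1.trans hTP) (hT.mono hss.1)
  have h1 := hdec j (hTP hj) (T ∩ D j) Finset.inter_subset_right
    ⟨j, Finset.mem_inter.2 ⟨hj, hjD⟩⟩
  -- A composite usable at `j` lies in `D j` together with the side information of `j`, and the
  -- sink's side information avoids `T`. So it cannot touch `T \ D j`, and no composite is charged
  -- twice.
  have hdisj : Disjoint
      ({J ∈ I.composites P | J ⊆ D j ∪ I.groupSide P j ∧ (J ∩ (T ∩ D j)).Nonempty})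
      ({J ∈ I.composites P | (J ∩ (T \ D j)).Nonempty}) := by
    rw [Finset.disjoint_left]
    intro J hJ hJ'
    simp only [Finset.mem_filter] at hJ hJ'
    obtain ⟨i, hi⟩ := hJ'.2
    simp only [Finset.mem_inter, Finset.mem_sdiff] at hi
    have := hJ.2.1 hi.1
    simp only [groupSide, Finset.mem_union, Finset.mem_inter] at this
    rcases this with h | h
    · exact hi.2.2 h
    · exact hsink i hi.2.1 h.1
  calc ∑ i ∈ T, r i = ∑ i ∈ T ∩ D j, r i + ∑ i ∈ T \ D j, r i :=
        (Finset.sum_inter_add_sum_sdiff T (D j) r).symm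
    _ ≤ _ := add_le_add h1.le h2
    _ = _ := (Finset.sum_union hdisj).symm
    _ ≤ _ := by
        refine Finset.sum_le_sum_of_subset_of_nonneg ?_ ?_
        · intro J hJ
          simp only [Finset.mem_union, Finset.mem_filter] at hJ ⊢
          rcases hJ with ⟨h, -, h'⟩ | ⟨h, h'⟩
          · exact ⟨h, h'.mono (Finset.inter_subset_inter_left Finset.inter_subset_left)⟩
          · exact ⟨h, h'.mono (Finset.inter_subset_inter_left Finset.sdiff_subset)⟩
        · intro J hJ _
          exact hγ J (Finset.mem_filter.1 hJ).1

/-- The MAIS bound within a group. -/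
lemma cccFixed_sum_lt {P : Finset (Fin K)} {c : Fin K → ℝ} {D : Fin N → Finset (Fin N)}
    (hD : I.IsDecodingChoice P D) {r : Fin N → ℝ} (hr : r ∈ I.cccFixed P c D)
    {T : Finset (Fin N)} (hTP : T ⊆ I.groupMsgs P) (hT : I.InducedAcyclic T)
    (hne : T.Nonempty) :
    ∑ i ∈ T, r i < ∑ k ∈ P with (I.S k ∩ T).Nonempty, c k := by
  obtain ⟨-, γ, hγ, hdec, hcap⟩ := hr
  refine (I.sum_le_sum_composites hD hγ hdec T hTP hT).trans_lt ?_
  obtain ⟨j, hj, hsink⟩ := hT.exists_sink hne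
  obtain ⟨k, hk, hjk⟩ := Finset.mem_biUnion.1 (hTP hj)
  -- Only senders of `Q` can form a composite touching `T`, and the sink `j` never knows such a
  -- composite entirely. Hence the link inequality of `Q` at `j` counts all of them.
  set Q := {k ∈ P | (I.S k ∩ T).Nonempty} with hQ
  have hQP : Q ⊆ P := Finset.filter_subset _ _
  refine lt_of_le_of_lt ?_ (hcap j (hTP hj) Q hQP
    ⟨k, Finset.mem_filter.2 ⟨hk, j, Finset.mem_inter.2 ⟨hjk, hj⟩⟩⟩)
  have hcomp : I.composites Q ⊆ I.composites P := by
    intro J hJ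
    simp only [composites, Finset.mem_filter, Finset.mem_univ, true_and] at hJ ⊢
    obtain ⟨k, hk, hJ⟩ := hJ
    exact ⟨k, hQP hk, hJ⟩
  refine Finset.sum_le_sum_of_subset_of_nonneg ?_ ?_
  · intro J hJ
    obtain ⟨hJP, i, hi⟩ := Finset.mem_filter.1 hJ
    rw [Finset.mem_inter] at hi
    simp only [composites, Finset.mem_filter, Finset.mem_univ, true_and] at hJP ⊢
    have key : ∀ k ∈ P, J ⊆ I.S k → k ∈ Q := fun k hk hJk =>
      Finset.mem_filter.2 ⟨hk, i, Finset.mem_inter.2 ⟨hJk hi.1, hi.2⟩⟩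
    obtain ⟨k, hk, hJk⟩ := hJP
    refine ⟨⟨k, key k hk hJk, hJk⟩, ?_, ?_⟩
    · rintro ⟨k', hk', hJk'⟩
      rw [Finset.mem_sdiff] at hk'
      exact hk'.2 (key k' hk'.1 hJk')
    · intro hJA
      exact hsink i hi.2 (Finset.mem_inter.1 (hJA hi.1)).1
  · intro J hJ _
    exact hγ J (hcomp (Finset.mem_filter.1 hJ).1)

lemma cccGroup_nonneg {P : Finset (Fin K)} {c : Fin K → ℝ} {r : Fin N → ℝ}
    (hr : r ∈ I.cccGroup P c) {j : Fin N} (hj : j ∈ I.groupMsgs P) : 0 ≤ r j := by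
  simp only [cccGroup, Set.mem_iUnion] at hr
  obtain ⟨D, -, hr⟩ := hr
  exact hr.1 j hj

lemma mem_groupMsgs_of_mem {P : Finset (Fin K)} {j : Fin N} {k : Fin K} (hk : k ∈ P)
    (hj : j ∈ I.S k) : j ∈ I.groupMsgs P := Finset.mem_biUnion.2 ⟨k, hk, hj⟩

/-- The MAIS bound within a group, for a set that may contain messages foreign to the group. -/
lemma cccGroup_sum_lt {P : Finset (Fin K)} {c : Fin K → ℝ} {r : Fin N → ℝ}
    (hr : r ∈ I.cccGroup P c) {T : Finset (Fin N)} (hT : I.InducedAcyclic T)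
    (hne : (T ∩ I.groupMsgs P).Nonempty) :
    ∑ i ∈ T ∩ I.groupMsgs P, r i < ∑ k ∈ P with (I.S k ∩ T).Nonempty, c k := by
  simp only [cccGroup, Set.mem_iUnion] at hr
  obtain ⟨D, hD, hr⟩ := hr
  convert I.cccFixed_sum_lt hD hr Finset.inter_subset_right
    (hT.mono Finset.inter_subset_left) hne using 2
  refine Finset.filter_congr fun k hk => ⟨?_, fun h =>
    h.mono (Finset.inter_subset_inter_left Finset.inter_subset_left)⟩
  rintro ⟨i, hi⟩
  rw [Finset.mem_inter] at hi
  exact ⟨i, by simp [hi.1, hi.2, I.mem_groupMsgs_of_mem hk hi.1]⟩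

lemma cccGroup_sum_le {P : Finset (Fin K)} {c : Fin K → ℝ} (hc : ∀ k, 0 ≤ c k)
    {r : Fin N → ℝ} (hr : r ∈ I.cccGroup P c) {T : Finset (Fin N)} (hT : I.InducedAcyclic T) :
    ∑ i ∈ T ∩ I.groupMsgs P, r i ≤ ∑ k ∈ P with (I.S k ∩ T).Nonempty, c k := by
  rcases (T ∩ I.groupMsgs P).eq_empty_or_nonempty with h | h
  · rw [h, Finset.sum_empty]
    exact Finset.sum_nonneg fun k _ => hc k
  · exact (I.cccGroup_sum_lt hr hT h).le

/-! ### Partitions of the senders -/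

lemma sum_parts_sum (Pi : Finpartition (Finset.univ : Finset (Fin K))) (f : Fin K → ℝ) :
    ∑ P ∈ Pi.parts, ∑ k ∈ P, f k = ∑ k, f k := by
  calc _ = ∑ k ∈ Pi.parts.biUnion id, f k := (Finset.sum_biUnion Pi.disjoint).symm
    _ = _ := by rw [Pi.biUnion_parts]

/-- Used with all weights 1 for the MAIS bound and with weights `(3, 2, 2, 3, 0)` for the DCC bound.
-/
lemma sum_combine (Pi : Finset (Finset (Fin K))) (r : Finset (Fin K) → Fin N → ℝ)
    (w : Fin N → ℝ) (T : Finset (Fin N)) :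
    ∑ j ∈ T, w j * ∑ P ∈ Pi with j ∈ I.groupMsgs P, r P j =
      ∑ P ∈ Pi, ∑ j ∈ T ∩ I.groupMsgs P, w j * r P j := by
  simp_rw [Finset.mul_sum, Finset.sum_filter]
  rw [Finset.sum_comm]
  refine Finset.sum_congr rfl fun P _ => ?_
  rw [← Finset.filter_mem_eq_inter, Finset.sum_filter]

/-- The MAIS bound for partitioned CCC. -/
lemma cccRegion_sum_lt (Pi : Finpartition (Finset.univ : Finset (Fin K))) {R : Fin N → ℝ}
    (hR : R ∈ I.cccRegion Pi.parts) {T : Finset (Fin N)} (hT : I.InducedAcyclic T)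
    (hne : T.Nonempty) :
    ∑ j ∈ T, R j < ∑ k with (I.S k ∩ T).Nonempty, I.C k := by
  obtain ⟨r, hr, hR⟩ := hR
  have h1 := I.sum_combine Pi.parts r 1 T
  simp only [_root_.Pi.one_apply, one_mul] at h1
  rw [Finset.sum_congr rfl fun j _ => hR j, h1, Finset.sum_filter, ← sum_parts_sum Pi]
  simp_rw [← Finset.sum_filter]
  obtain ⟨j, hj⟩ := hne
  obtain ⟨k, hk⟩ := I.covers j
  obtain ⟨P, ⟨hP, hkP⟩⟩ := Pi.exists_mem (Finset.mem_univ k)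
  -- A group that meets no message of `T` gives only `≤`; the group of a sender that knows `j`
  -- supplies the strictness.
  exact Finset.sum_lt_sum (fun P hP => I.cccGroup_sum_le (fun k => (I.C_pos k).le) (hr P hP) hT)
    ⟨P, hP, I.cccGroup_sum_lt (hr P hP) hT
      ⟨j, Finset.mem_inter.2 ⟨hj, I.mem_groupMsgs_of_mem hkP hk⟩⟩⟩

lemma cccRegion_nonneg (Pi : Finset (Finset (Fin K))) {R : Fin N → ℝ}
    (hR : R ∈ I.cccRegion Pi) (j : Fin N) : 0 ≤ R j := by
  obtain ⟨r, hr, hR⟩ := hR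
  rw [hR]
  exact Finset.sum_nonneg fun P hP =>
    I.cccGroup_nonneg (hr P (Finset.mem_filter.1 hP).1) (Finset.mem_filter.1 hP).2

/-! ### Cooperation does not hurt -/

/-- The indices that different senders form from the same composite are merged into one common
index, whose rate is the sum. A composite counted for `Q` is formed by no sender of `P \ Q`, so its
whole rate is carried by links of `Q`, and the individual link inequalities add up. -/
lemma dccFixed_subset_cccFixed (P : Finset (Fin K)) (D : Fin N → Finset (Fin N)) :
    I.dccFixed P D ⊆ I.cccFixed P I.C D := by
  rintro r ⟨hr, γ, hγ, hdec, hcap⟩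
  refine ⟨hr, fun J => ∑ k ∈ P with J ⊆ I.S k, γ k J, ?_, ?_, ?_⟩
  · intro J _
    exact Finset.sum_nonneg fun k hk =>
      hγ k (Finset.mem_filter.1 hk).1 J (Finset.mem_filter.1 hk).2
  · intro j hj T hT hne
    refine (hdec j hj T hT hne).trans_eq ?_
    symm
    refine Finset.sum_subset (Finset.filter_subset_filter _ (Finset.subset_univ _)) ?_
    intro J hJ hJ'
    refine Finset.sum_eq_zero fun k hk => absurd ?_ hJ'
    rw [Finset.mem_filter] at hk hJ ⊢
    exact ⟨by simpa [composites] using ⟨k, hk⟩, hJ.2⟩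
  · intro j hj Q hQP hQ
    refine lt_of_le_of_lt ?_ (Finset.sum_lt_sum_of_nonempty hQ fun k hk => hcap j hj k (hQP hk))
    set F := {J ∈ I.composites Q | J ∉ I.composites (P \ Q) ∧ ¬ J ⊆ I.groupSide P j} with hF
    have hFQ : ∀ J k, J ∈ F ∧ k ∈ ({k ∈ P | J ⊆ I.S k} : Finset (Fin K)) ↔
        J ∈ ({J ∈ F | J ⊆ I.S k} : Finset (Finset (Fin N))) ∧ k ∈ Q := by
      intro J k
      simp only [hF, composites, Finset.mem_filter, Finset.mem_univ, true_and, Finset.mem_sdiff]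
      constructor
      · rintro ⟨⟨h1, h2, h3⟩, hk, hJk⟩
        refine ⟨⟨⟨h1, h2, h3⟩, hJk⟩, ?_⟩
        by_contra hkQ
        exact h2 ⟨k, ⟨hk, hkQ⟩, hJk⟩
      · rintro ⟨⟨h, hJk⟩, hk⟩
        exact ⟨h, hQP hk, hJk⟩
    rw [Finset.sum_comm' hFQ]
    refine Finset.sum_le_sum fun k hk => Finset.sum_le_sum_of_subset_of_nonneg ?_ ?_
    · intro J hJ
      simp only [hF, Finset.mem_filter, Finset.mem_powerset] at hJ ⊢
      exact ⟨hJ.2, hJ.1.2.2⟩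
    · intro J hJ _
      exact hγ k (hQP hk) J (Finset.mem_powerset.1 (Finset.mem_filter.1 hJ).1)

end IndexProblem

namespace IndexProblem

variable {N K : ℕ} (I : IndexProblem N K)

/-- A set is acyclic if the side information decreases a rank function on it. -/
lemma inducedAcyclic_of_rank {T : Finset (Fin N)} (f : Fin N → ℕ)
    (hf : ∀ i ∈ T, ∀ j ∈ T, j ∈ I.A i → f j < f i) : I.InducedAcyclic T := by
  have key : ∀ a b, Relation.TransGen
      (fun i j => i ∈ T ∧ j ∈ T ∧ I.sideInfoGraph.Adj i j) a b → f b < f a := by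
    intro a b h
    induction h with
    | single h => exact hf _ h.1 _ h.2.1 h.2.2
    | tail _ h ih => exact (hf _ h.1 _ h.2.1 h.2.2).trans ih
  exact fun v hv => lt_irrefl _ (key v v hv)

/-! ### Linear combinations of composite rates with natural coefficients -/

/-- The linear form with coefficients `f` evaluated at the rates `γ`. -/
noncomputable def weighted {ι : Type*} (s : Finset ι) (γ : ι → ℝ) (f : ι → ℕ) : ℝ := ∑ J ∈ s, (f J : ℝ) * γ J

lemma weighted_add {ι : Type*} (s : Finset ι) (γ : ι → ℝ) (f g : ι → ℕ) :
    weighted s γ (f + g) = weighted s γ f + weighted s γ g := by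
  simp [weighted, add_mul, Finset.sum_add_distrib]

lemma weighted_nsmul {ι : Type*} (s : Finset ι) (γ : ι → ℝ) (n : ℕ) (f : ι → ℕ) :
    weighted s γ (n • f) = n * weighted s γ f := by
  simp [weighted, Finset.mul_sum, mul_assoc]

/-- Reduces a certificate to a comparison of natural coefficients over a finite set of composites,
which `decide` can check. -/
lemma weighted_mono {ι : Type*} {s : Finset ι} {γ : ι → ℝ} (hγ : ∀ J ∈ s, 0 ≤ γ J)
    {f g : ι → ℕ} (h : ∀ J ∈ s, f J ≤ g J) : weighted s γ f ≤ weighted s γ g :=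
  Finset.sum_le_sum fun J hJ => mul_le_mul_of_nonneg_right (by exact_mod_cast h J hJ) (hγ J hJ)

/-- Indicator of the composite messages inside `U` that involve a message of `T`. -/
def decWeight (U T : Finset (Fin N)) (J : Finset (Fin N)) : ℕ :=
  if J ⊆ U ∧ (J ∩ T).Nonempty then 1 else 0

/-- Indicator of the composite messages that count towards the links of `Q` at receiver `j`. -/
def capWeight (P Q : Finset (Fin K)) (j : Fin N) (J : Finset (Fin N)) : ℕ :=
  if J ∈ I.composites Q ∧ J ∉ I.composites (P \ Q) ∧ ¬ J ⊆ I.groupSide P j then 1 else 0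

/-- Enlarging the usable set to `U` weakens the inequality but makes the coefficients independent of
the unknown `D`, so that they can be evaluated. -/
lemma sum_lt_weighted_decWeight {P : Finset (Fin K)} {D : Fin N → Finset (Fin N)}
    {r : Fin N → ℝ} {γ : Finset (Fin N) → ℝ} (hγ : ∀ J ∈ I.composites P, 0 ≤ γ J)
    {j : Fin N} {T U : Finset (Fin N)}
    (hdec : ∑ i ∈ T, r i <
          ∑ J ∈ I.composites P with J ⊆ D j ∪ I.groupSide P j ∧ (J ∩ T).Nonempty, γ J)
    (hU : D j ∪ I.groupSide P j ⊆ U) :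
    ∑ i ∈ T, r i < weighted (I.composites P) γ (decWeight U T) := by
  refine hdec.trans_le ?_
  simp only [weighted, decWeight, Nat.cast_ite, Nat.cast_one, Nat.cast_zero, ite_mul, one_mul,
    zero_mul, ← Finset.sum_filter]
  refine Finset.sum_le_sum_of_subset_of_nonneg ?_ fun J hJ _ => hγ J (Finset.mem_filter.1 hJ).1
  intro J hJ
  rw [Finset.mem_filter] at hJ ⊢
  exact ⟨hJ.1, hJ.2.1.trans hU, hJ.2.2⟩

lemma weighted_capWeight_lt {P Q : Finset (Fin K)} (hQ : Q ⊆ P) {c : ℝ}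
    {γ : Finset (Fin N) → ℝ} {j : Fin N}
    (hcap : ∑ J ∈ I.composites Q with J ∉ I.composites (P \ Q) ∧ ¬ J ⊆ I.groupSide P j, γ J < c) :
    weighted (I.composites P) γ (I.capWeight P Q j) < c := by
  refine lt_of_eq_of_lt ?_ hcap
  simp only [weighted, capWeight, Nat.cast_ite, Nat.cast_one, Nat.cast_zero, ite_mul, one_mul,
    zero_mul, ← Finset.sum_filter]
  congr 1
  ext J
  simp only [Finset.mem_filter]
  refine ⟨fun h => h.2, fun h => ⟨?_, h⟩⟩
  simp only [composites, Finset.mem_filter, Finset.mem_univ, true_and] at h ⊢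
  obtain ⟨⟨k, hk, hJ⟩, -⟩ := h
  exact ⟨k, hQ hk, hJ⟩

/-- Indicator of the composite indices of sender `k` that are new to receiver `j`. -/
def linkWeight (P : Finset (Fin K)) (k : Fin K) (j : Fin N) (x : Fin K × Finset (Fin N)) : ℕ :=
  if x.1 = k ∧ ¬ x.2 ⊆ I.groupSide P j then 1 else 0

/-- The composite indices of distributed composite coding in the group `P`. -/
def senderComposites (P : Finset (Fin K)) : Finset (Fin K × Finset (Fin N)) :=
  {x | x.1 ∈ P ∧ x.2 ⊆ I.S x.1}

lemma sum_lt_weighted_sender {P : Finset (Fin K)} {D : Fin N → Finset (Fin N)}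
    {r : Fin N → ℝ} {γ : Fin K → Finset (Fin N) → ℝ}
    (hγ : ∀ k ∈ P, ∀ J ⊆ I.S k, 0 ≤ γ k J) {j : Fin N} {T U : Finset (Fin N)}
    (hdec : ∑ i ∈ T, r i <
          ∑ J : Finset (Fin N) with J ⊆ D j ∪ I.groupSide P j ∧ (J ∩ T).Nonempty,
            ∑ k ∈ P with J ⊆ I.S k, γ k J)
    (hU : D j ∪ I.groupSide P j ⊆ U) :
    ∑ i ∈ T, r i <
      weighted (I.senderComposites P) (fun x => γ x.1 x.2) (fun x => decWeight U T x.2) := by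
  refine hdec.trans_le ?_
  simp only [weighted, decWeight, Nat.cast_ite, Nat.cast_one, Nat.cast_zero, ite_mul, one_mul,
    zero_mul, ← Finset.sum_filter]
  rw [Finset.sum_sigma']
  refine le_of_eq_of_le (Finset.sum_bij' (t := {x ∈ I.senderComposites P |
      x.2 ⊆ D j ∪ I.groupSide P j ∧ (x.2 ∩ T).Nonempty}) (g := fun x => γ x.1 x.2)
      (fun x _ => (x.2, x.1)) (fun x _ => ⟨x.2, x.1⟩) ?_ ?_ ?_ ?_ ?_) ?_
  · rintro ⟨J, k⟩ h
    simpa [senderComposites, and_assoc, and_comm, and_left_comm] using h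
  · rintro ⟨k, J⟩ h
    simpa [senderComposites, and_assoc, and_comm, and_left_comm] using h
  · simp
  · simp
  · simp
  · refine Finset.sum_le_sum_of_subset_of_nonneg ?_ ?_
    · intro x hx
      rw [Finset.mem_filter] at hx ⊢
      exact ⟨hx.1, hx.2.1.trans hU, hx.2.2⟩
    · intro x hx _
      have := (Finset.mem_filter.1 hx).1
      simp only [senderComposites, Finset.mem_filter, Finset.mem_univ, true_and] at this
      exact hγ _ this.1 _ this.2

lemma weighted_linkWeight_lt {P : Finset (Fin K)} {k : Fin K} (hk : k ∈ P) {c : ℝ}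
    {γ : Fin K → Finset (Fin N) → ℝ} {j : Fin N}
    (hcap : ∑ J ∈ (I.S k).powerset with ¬ J ⊆ I.groupSide P j, γ k J < c) :
    weighted (I.senderComposites P) (fun x => γ x.1 x.2) (I.linkWeight P k j) < c := by
  refine lt_of_eq_of_lt ?_ hcap
  simp only [weighted, linkWeight, Nat.cast_ite, Nat.cast_one, Nat.cast_zero, ite_mul, one_mul,
    zero_mul, ← Finset.sum_filter]
  refine Finset.sum_bij' (fun x _ => x.2) (fun J _ => (k, J)) ?_ ?_ ?_ ?_ ?_
  · rintro ⟨k', J⟩ h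
    simp only [senderComposites, Finset.mem_filter, Finset.mem_univ, true_and,
      Finset.mem_powerset] at h ⊢
    obtain ⟨⟨-, h⟩, rfl, h'⟩ := h
    exact ⟨h, h'⟩
  · intro J h
    simpa [senderComposites, hk] using h
  · rintro ⟨k', J⟩ h
    simp only [Finset.mem_filter] at h
    simp [h.2.1]
  · simp
  · rintro ⟨k', J⟩ h
    simp only [Finset.mem_filter] at h
    simp [h.2.1]

end IndexProblem

open IndexProblem

/-! ### The outer bounds for the instance -/

/-- The acyclic sets behind the inequalities of the explicit region. -/
def boundingSets : List (Finset (Fin 5)) :=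
  [{0}, {2}, {4}, {0, 2}, {3, 4}, {0, 1, 4}, {1, 3, 4}, {2, 3, 4}]

lemma inducedAcyclic_of_mem_boundingSets {T : Finset (Fin 5)} (hT : T ∈ boundingSets) :
    fourSenderProblem.InducedAcyclic T := by
  -- Four rank functions serve all eight sets.
  have h1 : ∀ T ∈ boundingSets, ∃ f ∈ [![0, 0, 1, 0, 0], ![1, 2, 0, 0, 0], ![0, 1, 0, 2, 0],
      ![0, 0, 0, 2, 1]], ∀ i ∈ T, ∀ j ∈ T, j ∈ fourSenderProblem.A i → f j < f i := by
    decide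
  obtain ⟨f, -, hf⟩ := h1 T hT
  exact fourSenderProblem.inducedAcyclic_of_rank f hf

lemma cccRegion_subset_fourSenderRegion (Pi : Finpartition (Finset.univ : Finset (Fin 4))) :
    fourSenderProblem.cccRegion Pi.parts ⊆ fourSenderRegion := by
  intro R hR
  have key : ∀ T ∈ boundingSets, T.Nonempty → ∑ j ∈ T, R j <
      (Finset.card {k | (fourSenderProblem.S k ∩ T).Nonempty} : ℕ) := by
    intro T hT hne
    simpa [fourSenderProblem] using fourSenderProblem.cccRegion_sum_lt Pi hR
      (inducedAcyclic_of_mem_boundingSets hT) hne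
  have c1 : Finset.card {k | (fourSenderProblem.S k ∩ {0}).Nonempty} = 2 := by decide
  have c2 : Finset.card {k | (fourSenderProblem.S k ∩ {2}).Nonempty} = 2 := by decide
  have c3 : Finset.card {k | (fourSenderProblem.S k ∩ {4}).Nonempty} = 1 := by decide
  have c4 : Finset.card {k | (fourSenderProblem.S k ∩ {0, 2}).Nonempty} = 3 := by decide
  have c5 : Finset.card {k | (fourSenderProblem.S k ∩ {3, 4}).Nonempty} = 2 := by decide
  have c6 : Finset.card {k | (fourSenderProblem.S k ∩ {0, 1, 4}).Nonempty} = 4 := by decide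
  have c7 : Finset.card {k | (fourSenderProblem.S k ∩ {1, 3, 4}).Nonempty} = 4 := by decide
  have c8 : Finset.card {k | (fourSenderProblem.S k ∩ {2, 3, 4}).Nonempty} = 3 := by decide
  simp only [boundingSets, List.forall_mem_cons, c1, c2, c3, c4, c5, c6, c7, c8] at key
  simp at key
  refine ⟨fourSenderProblem.cccRegion_nonneg _ hR, ?_⟩
  obtain ⟨h1, h2, h3, h4, h5, h6, h7, h8⟩ := key
  refine ⟨h1, h2, h3, h4, h5, ?_, ?_, ?_⟩ <;> linarith

lemma convex_fourSenderRegion : Convex ℝ fourSenderRegion := by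
  rintro x ⟨hx0, hx⟩ y ⟨hy0, hy⟩ a b ha hb hab
  refine ⟨fun j => add_nonneg (mul_nonneg ha (hx0 j)) (mul_nonneg hb (hy0 j)), ?_⟩
  have key : ∀ s t c : ℝ, s < c → t < c → a * s + b * t < c := by
    intro s t c hs ht
    simpa using (convex_Iio (𝕜 := ℝ) c) hs ht ha hb hab
  simp only [Pi.add_apply, Pi.smul_apply, smul_eq_mul]
  obtain ⟨h1, h2, h3, h4, h5, h6, h7, h8⟩ := hx
  obtain ⟨g1, g2, g3, g4, g5, g6, g7, g8⟩ := hy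
  refine ⟨key _ _ _ h1 g1, key _ _ _ h2 g2, key _ _ _ h3 g3, ?_, ?_, ?_, ?_, ?_⟩
  · linarith [key _ _ _ h4 g4]
  · linarith [key _ _ _ h5 g5]
  · linarith [key _ _ _ h6 g6]
  · linarith [key _ _ _ h7 g7]
  · linarith [key _ _ _ h8 g8]

lemma RCS_subset_fourSenderRegion : fourSenderProblem.RCS ⊆ fourSenderRegion :=
  convexHull_min (Set.iUnion_subset cccRegion_subset_fourSenderRegion) convex_fourSenderRegion

lemma fourSenderProblem_C (k : Fin 4) : fourSenderProblem.C k = 1 := rfl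

/-! ### All senders in one cooperating group -/

/-- A single group of all senders has sum rate at most `6` for the first four messages. -/
lemma cccGroup_univ_sum_lt {r : Fin 5 → ℝ}
    (hr : r ∈ fourSenderProblem.cccGroup Finset.univ fourSenderProblem.C) :
    r 0 + r 1 + r 2 + r 3 < 6 := by
  simp only [cccGroup, Set.mem_iUnion] at hr
  obtain ⟨D, hD, -, γ, hγ, hdec, hcap⟩ := hr
  have hmsg : ∀ j, j ∈ fourSenderProblem.groupMsgs Finset.univ := by decide
  have dec (j : Fin 5) (T U : Finset (Fin 5)) (hT : T ⊆ D j) (hne : T.Nonempty)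
      (hU : D j ∪ fourSenderProblem.groupSide Finset.univ j ⊆ U) :=
    fourSenderProblem.sum_lt_weighted_decWeight hγ (hdec j (hmsg j) T hT hne) hU
  have cap (j : Fin 5) (Q : Finset (Fin 4)) (hQ : Q.Nonempty) :=
    fourSenderProblem.weighted_capWeight_lt (Finset.subset_univ Q)
      (hcap j (hmsg j) Q (Finset.subset_univ Q) hQ)
  have dec1 (j : Fin 5) := dec j {j} Finset.univ
    (Finset.singleton_subset_iff.2 (hD j (hmsg j)).1) (by simp) (Finset.subset_univ _)
  -- If `1 ∈ D 0`, the certificate uses `cap0` and `cap1` (capacities 4 and 2), otherwise `cap0'`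
  -- and `cap4` (2 and 4); both give 6. The pairs of senders work because only senders 1 and 3 know
  -- message 3 and only senders 0 and 1 know message 2, so composites with these messages are
  -- exclusive to their pair.
  have cap0 := cap 0 Finset.univ (by decide)
  have cap1 := cap 1 {1, 3} (by decide)
  have cap0' := cap 0 {0, 1} (by decide)
  have cap4 := cap 4 Finset.univ (by decide)
  have d2 := dec1 2
  have d3 := dec1 3
  simp [fourSenderProblem_C] at cap0 cap1 cap0' cap4 d2 d3
  have u0 : ∀ X : Finset (Fin 5),
      X ⊆ fourSenderProblem.groupMsgs Finset.univ \ fourSenderProblem.groupSide Finset.univ 0 →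
      (2 ∉ X → X ∪ fourSenderProblem.groupSide Finset.univ 0 ⊆ {0, 1, 3, 4}) ∧
      (1 ∉ X → X ∪ fourSenderProblem.groupSide Finset.univ 0 ⊆ {0, 2, 3, 4}) := by decide
  have u1 : ∀ X : Finset (Fin 5),
      X ⊆ fourSenderProblem.groupMsgs Finset.univ \ fourSenderProblem.groupSide Finset.univ 1 →
      3 ∉ X → X ∪ fourSenderProblem.groupSide Finset.univ 1 ⊆ {0, 1, 2, 4} := by decide
  have h0 := (hD 0 (hmsg 0)).1
  have h1 := (hD 1 (hmsg 1)).1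
  by_cases h10 : 1 ∈ D 0
  · by_cases h20 : 2 ∈ D 0
    · have d0 := dec 0 {0, 1, 2} Finset.univ (by simp [Finset.insert_subset_iff, *])
        (by simp) (Finset.subset_univ _)
      have key := weighted_mono hγ
        (f := decWeight Finset.univ {0, 1, 2} + decWeight Finset.univ {3})
        (g := fourSenderProblem.capWeight Finset.univ Finset.univ 0 +
          fourSenderProblem.capWeight Finset.univ {1, 3} 1) (by decide)
      simp only [weighted_add] at key
      simp at d0
      linarith
    · have d0 := dec 0 {0, 1} _ (by simp [Finset.insert_subset_iff, *])
        (by simp) ((u0 _ (hD 0 (hmsg 0)).2).1 h20)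
      have key := weighted_mono hγ
        (f := decWeight {0, 1, 3, 4} {0, 1} + decWeight Finset.univ {2} +
          decWeight Finset.univ {3})
        (g := fourSenderProblem.capWeight Finset.univ Finset.univ 0 +
          fourSenderProblem.capWeight Finset.univ {1, 3} 1) (by decide)
      simp only [weighted_add] at key
      simp at d0
      linarith
  · have d0 := dec 0 {0} _ (by simp [*]) (by simp) ((u0 _ (hD 0 (hmsg 0)).2).2 h10)
    by_cases h31 : 3 ∈ D 1
    · have d1 := dec 1 {1, 3} Finset.univ (by simp [Finset.insert_subset_iff, *])
        (by simp) (Finset.subset_univ _)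
      have key := weighted_mono hγ
        (f := decWeight {0, 2, 3, 4} {0} + decWeight Finset.univ {1, 3} +
          decWeight Finset.univ {2})
        (g := fourSenderProblem.capWeight Finset.univ {0, 1} 0 +
          fourSenderProblem.capWeight Finset.univ Finset.univ 4) (by decide)
      simp only [weighted_add] at key
      simp at d0 d1
      linarith
    · have d1 := dec 1 {1} _ (by simp [*]) (by simp) (u1 _ (hD 1 (hmsg 1)).2 h31)
      have key := weighted_mono hγ
        (f := decWeight {0, 2, 3, 4} {0} + decWeight {0, 1, 2, 4} {1} +
          decWeight Finset.univ {2} + decWeight Finset.univ {3})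
        (g := fourSenderProblem.capWeight Finset.univ {0, 1} 0 +
          fourSenderProblem.capWeight Finset.univ Finset.univ 4) (by decide)
      simp only [weighted_add] at key
      simp at d0 d1
      linarith

lemma RC_sum_lt {R : Fin 5 → ℝ} (hR : R ∈ fourSenderProblem.RC) :
    R 0 + R 1 + R 2 + R 3 < 6 := by
  have hconv : Convex ℝ {R : Fin 5 → ℝ | R 0 + R 1 + R 2 + R 3 < 6} := by
    refine convex_halfSpace_lt (f := fun R : Fin 5 → ℝ => R 0 + R 1 + R 2 + R 3) ⟨?_, ?_⟩ 6
    · intro x y; simp only [Pi.add_apply]; ring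
    · intro a x; simp only [Pi.smul_apply, smul_eq_mul]; ring
  refine convexHull_min ?_ hconv hR
  rintro R ⟨r, hr, hRr⟩
  have h := cccGroup_univ_sum_lt (hr Finset.univ (Finset.mem_singleton_self _))
  have hmsg : ∀ j, j ∈ fourSenderProblem.groupMsgs Finset.univ := by decide
  simpa [hRr, Finset.sum_filter, hmsg] using h

/-! ### Distributed composite coding -/

set_option maxRecDepth 8000 in
/-- Without cooperation the first two senders miss the MAIS bound of their group. -/
lemma dccGroup_pair_sum_lt {r : Fin 5 → ℝ} (hr : r ∈ fourSenderProblem.dccGroup {0, 1}) :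
    3 * r 0 + 2 * r 1 + 2 * r 2 + 3 * r 3 < 9 := by
  simp only [dccGroup, Set.mem_iUnion] at hr
  obtain ⟨D, hD, hr0, γ, hγ, hdec, hcap⟩ := hr
  have hγ' : ∀ x ∈ fourSenderProblem.senderComposites {0, 1}, 0 ≤ γ x.1 x.2 := by
    intro x hx
    simp only [senderComposites, Finset.mem_filter, Finset.mem_univ, true_and] at hx
    exact hγ _ hx.1 _ hx.2
  have hmsg : ∀ j : Fin 5, j ≠ 4 → j ∈ fourSenderProblem.groupMsgs {0, 1} := by decide
  have m0 := hmsg 0 (by decide)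
  have m1 := hmsg 1 (by decide)
  -- The certificates for `D 0` without messages 1 and 2 bound `4 * r 0 + 2 * r 1 + 2 * r 2 + 3 * r
  -- 3`; the surplus `r 0` is dropped by nonnegativity.
  have hr0 := hr0 0 m0
  have dec (j : Fin 5) (T U : Finset (Fin 5)) (hj : j ≠ 4) (hT : T ⊆ D j) (hne : T.Nonempty)
      (hU : D j ∪ fourSenderProblem.groupSide {0, 1} j ⊆ U) :=
    fourSenderProblem.sum_lt_weighted_sender hγ (hdec j (hmsg j hj) T hT hne) hU
  have cap (j : Fin 5) (k : Fin 4) (hj : j ≠ 4) (hk : k ∈ ({0, 1} : Finset (Fin 4))) :=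
    fourSenderProblem.weighted_linkWeight_lt hk (hcap j (hmsg j hj) k hk)
  have dec1 (j : Fin 5) (hj : j ≠ 4) := dec j {j} Finset.univ hj
    (Finset.singleton_subset_iff.2 (hD j (hmsg j hj)).1) (by simp) (Finset.subset_univ _)
  -- These link inequalities enter with multipliers 3, 3, 2, or 4, 3, 2 when `D 0` contains neither
  -- 1 nor 2. The totals are 8 and 9, whereas cooperation comes arbitrarily close to 10 at rates
  -- near `(1, 1, 1, 1)`.
  have c00 := cap 0 0 (by decide) (by decide)
  have c11 := cap 1 1 (by decide) (by decide)
  have c21 := cap 2 1 (by decide) (by decide)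
  have d1 := dec1 1 (by decide)
  have d2 := dec1 2 (by decide)
  have d3 := dec1 3 (by decide)
  simp [fourSenderProblem_C] at c00 c11 c21 d1 d2 d3
  have u0 : ∀ X : Finset (Fin 5),
      X ⊆ fourSenderProblem.groupMsgs {0, 1} \ fourSenderProblem.groupSide {0, 1} 0 →
      (2 ∉ X → X ∪ fourSenderProblem.groupSide {0, 1} 0 ⊆ {0, 1, 3}) ∧
      (1 ∉ X → X ∪ fourSenderProblem.groupSide {0, 1} 0 ⊆ {0, 2, 3}) ∧
      (1 ∉ X → 2 ∉ X → X ∪ fourSenderProblem.groupSide {0, 1} 0 ⊆ {0, 3}) := by decide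
  have u1 : ∀ X : Finset (Fin 5),
      X ⊆ fourSenderProblem.groupMsgs {0, 1} \ fourSenderProblem.groupSide {0, 1} 1 →
      3 ∉ X → X ∪ fourSenderProblem.groupSide {0, 1} 1 ⊆ {0, 1, 2} := by decide
  replace u0 := u0 _ (hD 0 m0).2
  have h0 := (hD 0 m0).1
  have h1 := (hD 1 m1).1
  by_cases h10 : 1 ∈ D 0
  · by_cases h20 : 2 ∈ D 0
    · have d0 := dec1 0 (by decide)
      have d0' := dec 0 {0, 1, 2} Finset.univ (by decide) (by simp [Finset.insert_subset_iff, *])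
        (by simp) (Finset.subset_univ _)
      have key := weighted_mono hγ'
        (f := 1 • (fun x => decWeight Finset.univ {0} x.2) +
          2 • (fun x => decWeight Finset.univ {0, 1, 2} x.2) +
          3 • (fun x => decWeight Finset.univ {3} x.2))
        (g := 3 • fourSenderProblem.linkWeight {0, 1} 0 0 +
          3 • fourSenderProblem.linkWeight {0, 1} 1 1 +
          2 • fourSenderProblem.linkWeight {0, 1} 1 2) (by decide)
      simp only [weighted_add, weighted_nsmul] at key
      simp at d0 d0'
      norm_num at key
      linarith
    · have d0 := dec 0 {0} _ (by decide) (by simp [*]) (by simp) (u0.1 h20)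
      have d0' := dec 0 {0, 1} _ (by decide) (by simp [Finset.insert_subset_iff, *])
        (by simp) (u0.1 h20)
      have key := weighted_mono hγ'
        (f := 1 • (fun x => decWeight {0, 1, 3} {0} x.2) +
          2 • (fun x => decWeight {0, 1, 3} {0, 1} x.2) +
          2 • (fun x => decWeight Finset.univ {2} x.2) +
          3 • (fun x => decWeight Finset.univ {3} x.2))
        (g := 3 • fourSenderProblem.linkWeight {0, 1} 0 0 +
          3 • fourSenderProblem.linkWeight {0, 1} 1 1 +
          2 • fourSenderProblem.linkWeight {0, 1} 1 2) (by decide)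
      simp only [weighted_add, weighted_nsmul] at key
      simp at d0 d0'
      norm_num at key
      linarith
  · by_cases h20 : 2 ∈ D 0
    · have d0 := dec 0 {0} _ (by decide) (by simp [*]) (by simp) (u0.2.1 h10)
      have d0' := dec 0 {0, 2} _ (by decide) (by simp [Finset.insert_subset_iff, *])
        (by simp) (u0.2.1 h10)
      have key := weighted_mono hγ'
        (f := 1 • (fun x => decWeight {0, 2, 3} {0} x.2) +
          2 • (fun x => decWeight {0, 2, 3} {0, 2} x.2) +
          2 • (fun x => decWeight Finset.univ {1} x.2) +
          3 • (fun x => decWeight Finset.univ {3} x.2))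
        (g := 3 • fourSenderProblem.linkWeight {0, 1} 0 0 +
          3 • fourSenderProblem.linkWeight {0, 1} 1 1 +
          2 • fourSenderProblem.linkWeight {0, 1} 1 2) (by decide)
      simp only [weighted_add, weighted_nsmul] at key
      simp at d0 d0'
      norm_num at key
      linarith
    · have d0 := dec 0 {0} _ (by decide) (by simp [*]) (by simp) (u0.2.2 h10 h20)
      by_cases h31 : 3 ∈ D 1
      · have d1' := dec 1 {3} Finset.univ (by decide) (by simp [*]) (by simp)
          (Finset.subset_univ _)
        have d1'' := dec 1 {1, 3} Finset.univ (by decide) (by simp [Finset.insert_subset_iff, *])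
          (by simp) (Finset.subset_univ _)
        have key := weighted_mono hγ'
          (f := 4 • (fun x => decWeight {0, 3} {0} x.2) +
          1 • (fun x => decWeight Finset.univ {3} x.2) +
          2 • (fun x => decWeight Finset.univ {1, 3} x.2) +
          2 • (fun x => decWeight Finset.univ {2} x.2))
          (g := 4 • fourSenderProblem.linkWeight {0, 1} 0 0 +
          3 • fourSenderProblem.linkWeight {0, 1} 1 1 +
          2 • fourSenderProblem.linkWeight {0, 1} 1 2) (by decide)
        simp only [weighted_add, weighted_nsmul] at key
        simp at d0 d1' d1''
        norm_num at key
        linarith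
      · have d1' := dec 1 {1} _ (by decide) (by simp [*]) (by simp) (u1 _ (hD 1 m1).2 h31)
        have key := weighted_mono hγ'
          (f := 4 • (fun x => decWeight {0, 3} {0} x.2) +
          2 • (fun x => decWeight {0, 1, 2} {1} x.2) +
          2 • (fun x => decWeight Finset.univ {2} x.2) +
          3 • (fun x => decWeight Finset.univ {3} x.2))
          (g := 4 • fourSenderProblem.linkWeight {0, 1} 0 0 +
          3 • fourSenderProblem.linkWeight {0, 1} 1 1 +
          2 • fourSenderProblem.linkWeight {0, 1} 1 2) (by decide)
        simp only [weighted_add, weighted_nsmul] at key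
        simp at d0 d1'
        norm_num at key
        linarith

lemma dccGroup_subset_cccGroup {N K : ℕ} (I : IndexProblem N K) (P : Finset (Fin K)) :
    I.dccGroup P ⊆ I.cccGroup P I.C :=
  Set.iUnion₂_mono fun D _ => I.dccFixed_subset_cccFixed P D

/-- The number of senders of `P` that know a message of `T`. -/
def touching (P : Finset (Fin 4)) (T : Finset (Fin 5)) : ℕ :=
  Finset.card {k ∈ P | (fourSenderProblem.S k ∩ T).Nonempty}

/-- A bound for the groups that is additive over the senders. -/
lemma dccGroup_sum_le {P : Finset (Fin 4)} {r : Fin 5 → ℝ}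
    (hr : r ∈ fourSenderProblem.dccGroup P) :
    ∑ j ∈ Finset.univ ∩ fourSenderProblem.groupMsgs P, (![3, 2, 2, 3, 0] j : ℝ) * r j ≤
      ∑ k ∈ P, (![9 / 2, 9 / 2, 4, 4] k : ℝ) := by
  have hc := dccGroup_subset_cccGroup _ _ hr
  -- Entries of `r` outside the group's messages are unconstrained and are replaced by 0.
  set q : Fin 5 → ℝ := fun j => if j ∈ fourSenderProblem.groupMsgs P then r j else 0 with hq
  have hsum : ∑ j ∈ Finset.univ ∩ fourSenderProblem.groupMsgs P, (![3, 2, 2, 3, 0] j : ℝ) * r j =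
      3 * q 0 + 2 * q 1 + 2 * q 2 + 3 * q 3 := by
    rw [← Finset.filter_mem_eq_inter, Finset.sum_filter]
    simp only [← mul_ite_zero, Fin.sum_univ_five, hq]
    simp
  have hmais : ∀ T ∈ ([{0, 1}, {0, 2}, {1, 3}, {2, 3}, {0}, {3}] : List (Finset (Fin 5))),
      ∑ j ∈ T, q j ≤ touching P T := by
    have h1 : ∀ T ∈ ([{0, 1}, {0, 2}, {1, 3}, {2, 3}, {0}, {3}] : List (Finset (Fin 5))),
        ∃ U ∈ boundingSets, T ⊆ U := by decide
    intro T hT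
    obtain ⟨U, hU, hTU⟩ := h1 T hT
    have h2 := fourSenderProblem.cccGroup_sum_le (fun k => (fourSenderProblem.C_pos k).le) hc
      ((inducedAcyclic_of_mem_boundingSets hU).mono hTU)
    rw [hq, ← Finset.sum_filter, Finset.filter_mem_eq_inter]
    simpa [fourSenderProblem_C, touching] using h2
  -- Each of the three combinations covers messages 0, 1, 2, 3 exactly 3, 2, 2, 3 times by acyclic
  -- sets; the factor 2 clears the halves. For every group except `{0, 1}` and the full one, some
  -- combination suffices.
  have hcov : ∀ P : Finset (Fin 4), P = {0, 1} ∨ P = Finset.univ ∨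
      2 * (touching P {0, 1} + touching P {1, 3} + 2 * touching P {2, 3} + 2 * touching P {0}) ≤
        ∑ k ∈ P, ![9, 9, 8, 8] k ∨
      2 * (2 * touching P {0, 1} + touching P {0, 2} + touching P {2, 3} + 2 * touching P {3}) ≤
        ∑ k ∈ P, ![9, 9, 8, 8] k ∨
      2 * (2 * touching P {0, 2} + 2 * touching P {1, 3} + touching P {0} + touching P {3}) ≤
        ∑ k ∈ P, ![9, 9, 8, 8] k := by decide
  have hcast : ∑ k ∈ P, (![9 / 2, 9 / 2, 4, 4] k : ℝ) =
      ((∑ k ∈ P, ![9, 9, 8, 8] k : ℕ) : ℝ) / 2 := by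
    rw [Nat.cast_sum, Finset.sum_div]
    refine Finset.sum_congr rfl fun k _ => ?_
    fin_cases k <;> norm_num
  rw [hsum]
  simp only [List.forall_mem_cons] at hmais
  simp at hmais
  obtain ⟨m01, m02, m13, m23, m0, m3⟩ := hmais
  rcases hcov P with h | h | h | h | h
  · subst h
    have hm : ∀ j : Fin 5, j ≠ 4 → j ∈ fourSenderProblem.groupMsgs {0, 1} := by decide
    have := dccGroup_pair_sum_lt hr
    simp [hq, hm]
    linarith
  · subst h
    have hm : ∀ j : Fin 5, j ∈ fourSenderProblem.groupMsgs Finset.univ := by decide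
    -- Twice the bound 6 plus the MAIS bounds 2 for messages 0 and 3 gives 16, below the required
    -- 17.
    have := cccGroup_univ_sum_lt hc
    have t0 : touching Finset.univ {0} = 2 := by decide
    have t3 : touching Finset.univ {3} = 2 := by decide
    rw [t0] at m0
    rw [t3] at m3
    simp [hq, hm, Fin.sum_univ_four] at m0 m3 ⊢
    linarith
  all_goals
    have h' : ((2 * _ : ℕ) : ℝ) ≤ ((∑ k ∈ P, ![9, 9, 8, 8] k : ℕ) : ℝ) := Nat.cast_le.2 h
    rw [hcast]
    push_cast at h' ⊢
    linarith

lemma RS_sum_le {R : Fin 5 → ℝ} (hR : R ∈ fourSenderProblem.RS) :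
    3 * R 0 + 2 * R 1 + 2 * R 2 + 3 * R 3 ≤ 17 := by
  have hconv : Convex ℝ {R : Fin 5 → ℝ | 3 * R 0 + 2 * R 1 + 2 * R 2 + 3 * R 3 ≤ 17} := by
    refine convex_halfSpace_le
      (f := fun R : Fin 5 → ℝ => 3 * R 0 + 2 * R 1 + 2 * R 2 + 3 * R 3) ⟨?_, ?_⟩ 17
    · intro x y; simp only [Pi.add_apply]; ring
    · intro a x; simp only [Pi.smul_apply, smul_eq_mul]; ring
  refine convexHull_min (Set.iUnion_subset fun Pi => ?_) hconv hR
  rintro R ⟨r, hr, hRr⟩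
  have h := Finset.sum_le_sum fun P hP => dccGroup_sum_le (hr P hP)
  rw [sum_parts_sum, ← fourSenderProblem.sum_combine] at h
  simp only [← hRr, Fin.sum_univ_five, Fin.sum_univ_four] at h
  simp at h
  norm_num at h
  exact h

lemma RS_subset_RCS : fourSenderProblem.RS ⊆ fourSenderProblem.RCS := by
  refine convexHull_mono (Set.iUnion_mono fun Pi => ?_)
  rintro R ⟨r, hr, hR⟩
  exact ⟨r, fun P hP => dccGroup_subset_cccGroup _ _ (hr P hP), hR⟩

lemma RC_subset_RCS : fourSenderProblem.RC ⊆ fourSenderProblem.RCS := by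
  refine convexHull_mono ?_
  have h : (Finset.univ : Finset (Fin 4)) ≠ ⊥ := by decide
  exact Set.subset_iUnion (fun Pi : Finpartition (Finset.univ : Finset (Fin 4)) =>
    fourSenderProblem.cccRegion Pi.parts) (Finpartition.indiscrete h)

/-! ### The inner bound for the partition `{{1,2},{3,4}}` -/

/-- Time-sharing parameters for a tuple in the closed region scaled by `n`. -/
lemma exists_timeSharing {α : Type*} [CommRing α] [LinearOrder α] [IsStrictOrderedRing α]
    {R : Fin 5 → α} {n : α} (hR : ∀ j, 0 ≤ R j)
    (h0 : R 0 ≤ 2 * n) (h2 : R 2 ≤ 2 * n) (h4 : R 4 ≤ n) (h02 : R 0 + R 2 ≤ 3 * n)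
    (h34 : R 3 + R 4 ≤ 2 * n) (h014 : R 0 + R 1 + R 4 ≤ 4 * n)
    (h134 : R 1 + R 3 + R 4 ≤ 4 * n) (h234 : R 2 + R 3 + R 4 ≤ 3 * n) :
    ∃ x p q s t : α, 0 ≤ x ∧ 0 ≤ p ∧ 0 ≤ q ∧ 0 ≤ s ∧ 0 ≤ t ∧ x ≤ n ∧ p + q + s + t = n ∧
      R 0 ≤ x + p + q ∧ R 1 ≤ 2 * n - x + p + s + 2 * t ∧ R 2 ≤ 2 * n - x ∧
      R 3 ≤ x + p ∧ R 4 ≤ q + s := by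
  have r0 := hR 0
  have r2 := hR 2
  have r3 := hR 3
  have r4 := hR 4
  -- The right-hand sides are the rates of the modes in `hasBitCode_units`. The choice is greedy:
  -- `X` caps `x` so that message 2 still fits, `z = x + p + q` is the least value serving messages
  -- 0 and 3, and `y = x + p` leaves room `R 4` for message 4. With `q + s = R 4` the bound for
  -- message 1 becomes `4 * n - z - R 4`.
  obtain ⟨X, hX1, hX2, hX⟩ : ∃ X, X ≤ n ∧ X ≤ 2 * n - R 2 ∧ (X = n ∨ X = 2 * n - R 2) :=
    ⟨min n (2 * n - R 2), min_le_left _ _, min_le_right _ _, min_choice _ _⟩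
  obtain ⟨z, hz1, hz2, hz⟩ : ∃ z, R 0 ≤ z ∧ R 3 ≤ z ∧ (z = R 0 ∨ z = R 3) :=
    ⟨max (R 0) (R 3), le_max_left _ _, le_max_right _ _, max_choice _ _⟩
  have hzX : z ≤ X + n := by rcases hX with rfl | rfl <;> rcases hz with rfl | rfl <;> linarith
  have h3X : R 3 ≤ X + n - R 4 := by rcases hX with rfl | rfl <;> linarith
  have hzR : R 1 ≤ 4 * n - z - R 4 := by rcases hz with rfl | rfl <;> linarith
  have hX0 : 0 ≤ X := by rcases hX with rfl | rfl <;> linarith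
  obtain ⟨y, hy1, hy2, hy⟩ : ∃ y, y ≤ z ∧ y ≤ X + n - R 4 ∧ (y = z ∨ y = X + n - R 4) :=
    ⟨min z (X + n - R 4), min_le_left _ _, min_le_right _ _, min_choice _ _⟩
  have h3y : R 3 ≤ y := by rcases hy with rfl | rfl <;> assumption
  obtain ⟨x, hx1, hx2, hx⟩ : ∃ x, x ≤ y ∧ x ≤ X ∧ (x = y ∨ x = X) :=
    ⟨min y X, min_le_left _ _, min_le_right _ _, min_choice _ _⟩
  refine ⟨x, y - x, z - y, R 4 - (z - y), n - (y - x) - R 4, ?_, by linarith, by linarith, ?_, ?_,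
    by linarith, by ring, by linarith, by linarith, by linarith, by linarith, by linarith⟩
  · rcases hx with rfl | rfl <;> linarith
  · rcases hy with rfl | rfl <;> linarith
  · rcases hx with rfl | rfl <;> linarith

/-- The strict version for the open region; `m` is the rate of the messages `2` and `3` that the
first group serves by a common composite message. -/
lemma exists_strict_timeSharing {R : Fin 5 → ℝ} (hR : R ∈ fourSenderRegion) :
    ∃ x m p q s t : ℝ, 0 < x ∧ 0 < m ∧ 0 < p ∧ 0 < q ∧ 0 < s ∧ 0 < t ∧ x < 1 ∧ x + m < 2 ∧
      p + q + s + t < 1 ∧ R 0 < x + (p + q) ∧ R 1 < m + (p + s + 2 * t) ∧ R 2 < m ∧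
      R 3 < x + p ∧ R 4 < q + s := by
  obtain ⟨hR, h0, h2, h4, h02, h34, h014, h134, h234⟩ := hR
  -- Each rate is raised by `10 * δ` and the time is cut to `1 - 5 * δ`. An inequality with three
  -- rates and bound 4 then loses `30 * δ + 20 * δ`, the largest loss.
  have ev : ∀ᶠ δ in 𝓝[>] (0 : ℝ), 0 < δ ∧ 50 * δ < 2 - R 0 ∧ 50 * δ < 2 - R 2 ∧
      50 * δ < 1 - R 4 ∧ 50 * δ < 3 - (R 0 + R 2) ∧ 50 * δ < 2 - (R 3 + R 4) ∧
      50 * δ < 4 - (R 0 + R 1 + R 4) ∧ 50 * δ < 4 - (R 1 + R 3 + R 4) ∧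
      50 * δ < 3 - (R 2 + R 3 + R 4) := by
    have small : ∀ a : ℝ, 0 < a → ∀ᶠ δ in 𝓝[>] (0 : ℝ), 50 * δ < a := fun a ha =>
      ((continuous_const.mul continuous_id).tendsto' (0 : ℝ) 0 (by simp)).eventually_lt_const ha
        |>.filter_mono nhdsWithin_le_nhds
    simp only [eventually_and]
    refine ⟨self_mem_nhdsWithin, ?_, ?_, ?_, ?_, ?_, ?_, ?_, ?_⟩ <;>
      exact small _ (by linarith)
  obtain ⟨δ, hδ, s0, s2, s4, s02, s34, s014, s134, s234⟩ := ev.exists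
  have r4 := hR 4
  obtain ⟨x, p, q, s, t, hx, hp, hq, hs, ht, hxn, hn, g0, g1, g2, g3, g4⟩ :=
    exists_timeSharing (R := fun j => R j + 10 * δ) (n := 1 - 5 * δ)
      (fun j => by linarith [hR j]) (by linarith) (by linarith) (by linarith) (by linarith)
      (by linarith) (by linarith) (by linarith) (by linarith)
  refine ⟨x + δ, 2 - x - 2 * δ, p + δ, q + δ, s + δ, t + δ, ?_⟩
  refine ⟨?_, ?_, ?_, ?_, ?_, ?_, ?_, ?_, ?_, ?_, ?_, ?_, ?_, ?_⟩ <;> linarith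

lemma exists_rate_split {a b R : ℝ} (ha : 0 < a) (hb : 0 < b) (hR : 0 ≤ R) (h : R < a + b) :
    ∃ u v, 0 ≤ u ∧ 0 ≤ v ∧ u < a ∧ v < b ∧ R = u + v := by
  have hab : 0 < a + b := add_pos ha hb
  refine ⟨R / (a + b) * a, R / (a + b) * b, by positivity, by positivity, ?_, ?_, by field_simp⟩
  · exact mul_lt_of_lt_one_left ha ((div_lt_one hab).2 h)
  · exact mul_lt_of_lt_one_left hb ((div_lt_one hab).2 h)

/-- The first group: composite messages `{1}`, `{4}` and `{2,3}`. -/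
lemma mem_cccGroup_first {r : Fin 5 → ℝ} {x m : ℝ} (hr : ∀ j, 0 ≤ r j) (hx : 0 < x) (hm : 0 < m)
    (hx1 : x < 1) (hxm : x + m < 2) (h0 : r 0 < x) (h1 : r 1 < m) (h2 : r 2 < m) (h3 : r 3 < x) :
    r ∈ fourSenderProblem.cccGroup {0, 1} fourSenderProblem.C := by
  simp only [cccGroup, Set.mem_iUnion]
  refine ⟨fun j => {j}, by unfold IsDecodingChoice; decide, fun j _ => hr j,
    fun J => (if J = {0} then x else 0) + (if J = {3} then x else 0) +
      (if J = {1, 2} then m else 0), fun J _ => by positivity, ?_, ?_⟩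
  · intro j hj T hT hne
    rw [(Finset.subset_singleton_iff.1 hT).resolve_left hne.ne_empty, Finset.sum_singleton]
    simp only [Finset.sum_add_distrib, Finset.sum_ite_eq']
    have key : ∀ j ∈ fourSenderProblem.groupMsgs {0, 1},
        let F := {J ∈ fourSenderProblem.composites {0, 1} |
          J ⊆ {j} ∪ fourSenderProblem.groupSide {0, 1} j ∧ (J ∩ {j}).Nonempty}
        j = 0 ∧ {0} ∈ F ∨ j = 1 ∧ {1, 2} ∈ F ∨ j = 2 ∧ {1, 2} ∈ F ∨ j = 3 ∧ {3} ∈ F := by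
      decide
    rcases key j hj with ⟨rfl, h⟩ | ⟨rfl, h⟩ | ⟨rfl, h⟩ | ⟨rfl, h⟩ <;>
      simp only [h, if_true] <;> split_ifs <;> linarith
  · intro j hj Q hQ hne
    simp only [Finset.sum_add_distrib, Finset.sum_ite_eq']
    -- Every receiver of the group knows one of the three composites, so the joint load is at most
    -- `x + m` or `2 * x`. For a single sender, `{1, 2}` does not count because both senders can
    -- form it.
    have key : ∀ j ∈ fourSenderProblem.groupMsgs {0, 1}, ∀ Q ∈ ({0, 1} : Finset (Fin 4)).powerset,
        Q.Nonempty →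
        let F := {J ∈ fourSenderProblem.composites Q |
          J ∉ fourSenderProblem.composites ({0, 1} \ Q) ∧
            ¬ J ⊆ fourSenderProblem.groupSide {0, 1} j}
        Q.card = 1 ∧ {1, 2} ∉ F ∧ ({0} ∉ F ∨ {3} ∉ F) ∨
        Q.card = 2 ∧ ({1, 2} ∉ F ∨ {0} ∉ F ∨ {3} ∉ F) := by decide
    have hC : ∑ k ∈ Q, fourSenderProblem.C k = Q.card := by simp [fourSenderProblem_C]
    rw [hC]
    rcases key j hj Q (Finset.mem_powerset.2 hQ) hne with ⟨hc, h, h' | h'⟩ | ⟨hc, h | h | h⟩ <;>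
      rw [hc] <;> simp only [h, if_false] <;> (try simp only [h', if_false]) <;>
      split_ifs <;> norm_num <;> linarith

/-- The second group: composite messages `{1,2}`, `{2,4}`, `{1}`, `{2}` and `{5}`. -/
lemma mem_cccGroup_second {r : Fin 5 → ℝ} {p q s t : ℝ} (hr : ∀ j, 0 ≤ r j) (hp : 0 < p)
    (hq : 0 < q) (hs : 0 < s) (ht : 0 < t) (h : p + q + s + t < 1) (h0 : r 0 < p + q)
    (h1 : r 1 < p + s + 2 * t) (h3 : r 3 < p) (h4 : r 4 < q + s) :
    r ∈ fourSenderProblem.cccGroup {2, 3} fourSenderProblem.C := by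
  simp only [cccGroup, Set.mem_iUnion]
  -- Receiver 0 does not know message 1 and must decode it to use `{0, 1}`; since it knows message
  -- 3, the composite `{1, 3}` helps.
  refine ⟨fun j => if j = 0 then {0, 1} else {j}, by unfold IsDecodingChoice; decide,
    fun j _ => hr j,
    fun J => (if J = {0, 1} then p else 0) + (if J = {1, 3} then p else 0) +
      (if J = {0} then q else 0) + (if J = {1} then s + 2 * t else 0) +
      (if J = {4} then q + s else 0), fun J _ => by positivity, ?_, ?_⟩
  · intro j hj T hT hne
    simp only [Finset.sum_add_distrib, Finset.sum_ite_eq']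
    have key : ∀ j ∈ fourSenderProblem.groupMsgs {2, 3},
        ∀ T ⊆ (if j = 0 then {0, 1} else {j} : Finset (Fin 5)), T.Nonempty →
        let F := {J ∈ fourSenderProblem.composites {2, 3} |
          J ⊆ (if j = 0 then {0, 1} else {j}) ∪ fourSenderProblem.groupSide {2, 3} j ∧
            (J ∩ T).Nonempty}
        T = {0} ∧ {0, 1} ∈ F ∧ {0} ∈ F ∨ T = {1} ∧ {0, 1} ∈ F ∧ {1} ∈ F ∨
        T = {0, 1} ∧ {0, 1} ∈ F ∧ {1, 3} ∈ F ∧ {0} ∈ F ∧ {1} ∈ F ∨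
        T = {3} ∧ {1, 3} ∈ F ∨ T = {4} ∧ {4} ∈ F := by
      decide
    rcases key j hj T hT hne with ⟨rfl, h, h'⟩ | ⟨rfl, h, h'⟩ | ⟨rfl, h, h', h'', h'''⟩ |
        ⟨rfl, h⟩ | ⟨rfl, h⟩
    · simp only [h, h', if_true, Finset.sum_singleton]
      split_ifs <;> linarith
    · simp only [h, h', if_true, Finset.sum_singleton]
      split_ifs <;> linarith
    · rw [Finset.sum_pair (by decide)]
      simp only [h, h', h'', h''', if_true]
      split_ifs <;> linarith
    · simp only [h, if_true, Finset.sum_singleton]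
      split_ifs <;> linarith
    · simp only [h, if_true, Finset.sum_singleton]
      split_ifs <;> linarith
  · intro j hj Q hQ hne
    simp only [Finset.sum_add_distrib, Finset.sum_ite_eq']
    -- All composites together have rate `2 * (p + q + s + t)`, so the joint constraint holds
    -- without side information. A single sender is charged at most `p + q` or `p + q + s`, since
    -- `{1}` is common to both.
    have key : ∀ j ∈ fourSenderProblem.groupMsgs {2, 3}, ∀ Q ∈ ({2, 3} : Finset (Fin 4)).powerset,
        Q.Nonempty →
        let F := {J ∈ fourSenderProblem.composites Q |
          J ∉ fourSenderProblem.composites ({2, 3} \ Q) ∧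
            ¬ J ⊆ fourSenderProblem.groupSide {2, 3} j}
        Q.card = 2 ∨ Q.card = 1 ∧ {1} ∉ F ∧
          ({0, 1} ∉ F ∧ {0} ∉ F ∨ {1, 3} ∉ F ∧ {4} ∉ F) := by decide
    have hC : ∑ k ∈ Q, fourSenderProblem.C k = Q.card := by simp [fourSenderProblem_C]
    rw [hC]
    rcases key j hj Q (Finset.mem_powerset.2 hQ) hne with hc | ⟨hc, h, ⟨h', h''⟩ | ⟨h', h''⟩⟩
    · rw [hc]
      split_ifs <;> norm_num <;> linarith
    · rw [hc]
      simp only [h, h', h'', if_false]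
      split_ifs <;> norm_num <;> linarith
    · rw [hc]
      simp only [h, h', h'', if_false]
      split_ifs <;> norm_num <;> linarith

lemma fourSenderRegion_subset_cccRegion :
    fourSenderRegion ⊆ fourSenderProblem.cccRegion pairPartition.parts := by
  intro R hR
  obtain ⟨x, m, p, q, s, t, hx, hm, hp, hq, hs, ht, hx1, hxm, hpq, h0, h1, h2, h3, h4⟩ :=
    exists_strict_timeSharing hR
  have hR0 := hR.1
  obtain ⟨u0, v0, hu0, hv0, lu0, lv0, e0⟩ := exists_rate_split hx (by positivity) (hR0 0) h0
  obtain ⟨u1, v1, hu1, hv1, lu1, lv1, e1⟩ := exists_rate_split hm (by positivity) (hR0 1) h1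
  obtain ⟨u3, v3, hu3, hv3, lu3, lv3, e3⟩ := exists_rate_split hx hp (hR0 3) h3
  have n2 := hR0 2
  have n4 := hR0 4
  refine ⟨fun P => if P = {0, 1} then ![u0, u1, R 2, u3, 0] else ![v0, v1, 0, v3, R 4], ?_, ?_⟩
  · have hne : ({2, 3} : Finset (Fin 4)) ≠ {0, 1} := by decide
    intro P hP
    simp only [pairPartition, Finset.mem_insert, Finset.mem_singleton] at hP
    rcases hP with rfl | rfl
    · beta_reduce
      rw [if_pos rfl]
      refine mem_cccGroup_first ?_ hx hm hx1 hxm lu0 lu1 h2 lu3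
      simp [Fin.forall_fin_succ, *]
    · beta_reduce
      rw [if_neg hne]
      refine mem_cccGroup_second ?_ hp hq hs ht hpq lv0 lv1 lv3 h4
      simp [Fin.forall_fin_succ, *]
  · have hne : ({0, 1} : Finset (Fin 4)) ≠ {2, 3} := by decide
    intro j
    have hj : ∀ j : Fin 5, (j ∈ fourSenderProblem.groupMsgs {0, 1} ↔ j ≠ 4) ∧
        (j ∈ fourSenderProblem.groupMsgs {2, 3} ↔ j ≠ 2) := by decide
    rw [Finset.sum_filter, pairPartition, Finset.sum_pair hne]
    simp only [if_neg hne.symm, if_true, (hj j).1, (hj j).2]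
    fin_cases j <;> simp [*]

namespace IndexProblem

variable {N K : ℕ} (I : IndexProblem N K)

/-! ### Zero-error codes -/

/-- There are encoders with message alphabets `M` and link alphabets `L` for which every receiver
can recover its message. -/
def HasZeroErrorCode (M : Fin N → Type) (L : Fin K → Type) : Prop :=
  ∃ enc : ∀ k : Fin K, (∀ i : {i // i ∈ I.S k}, M i) → L k,
    ∀ j (m m' : ∀ i, M i), (∀ k, enc k (fun i => m i) = enc k fun i => m' i) →
      (∀ i ∈ I.A j, m i = m' i) → m j = m' j

variable {I}

lemma HasZeroErrorCode.map {M M' : Fin N → Type} {L L' : Fin K → Type}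
    (h : I.HasZeroErrorCode M L) (f : ∀ j, M' j → M j) (hf : ∀ j, Function.Injective (f j))
    (g : ∀ k, L k → L' k) (hg : ∀ k, Function.Injective (g k)) : I.HasZeroErrorCode M' L' := by
  obtain ⟨enc, h⟩ := h
  refine ⟨fun k m => g k (enc k fun i => f i (m i)), fun j m m' hL hA => hf j ?_⟩
  exact h j (fun i => f i (m i)) (fun i => f i (m' i)) (fun k => hg k (hL k))
    fun i hi => by rw [hA i hi]

lemma HasZeroErrorCode.prod {M M' : Fin N → Type} {L L' : Fin K → Type}
    (h : I.HasZeroErrorCode M L) (h' : I.HasZeroErrorCode M' L') :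
    I.HasZeroErrorCode (fun j => M j × M' j) (fun k => L k × L' k) := by
  obtain ⟨enc, h⟩ := h
  obtain ⟨enc', h'⟩ := h'
  refine ⟨fun k m => (enc k fun i => (m i).1, enc' k fun i => (m i).2), fun j m m' hL hA => ?_⟩
  exact Prod.ext
    (h j (fun i => (m i).1) (fun i => (m' i).1) (fun k => congrArg Prod.fst (hL k))
      fun i hi => by rw [hA i hi])
    (h' j (fun i => (m i).2) (fun i => (m' i).2) (fun k => congrArg Prod.snd (hL k))
      fun i hi => by rw [hA i hi])

variable (I)

/-- There is a zero-error code with `a j` bits for message `j` and `b k` bits on link `k`. -/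
def HasBitCode (a : Fin N → ℕ) (b : Fin K → ℕ) : Prop :=
  I.HasZeroErrorCode (fun j => Fin (2 ^ a j)) (fun k => Fin (2 ^ b k))

variable {I}

lemma HasBitCode.mono {a a' : Fin N → ℕ} {b b' : Fin K → ℕ} (h : I.HasBitCode a b)
    (ha : a' ≤ a) (hb : b ≤ b') : I.HasBitCode a' b' :=
  h.map (fun j => Fin.castLE (Nat.pow_le_pow_right two_pos (ha j)))
    (fun _ => Fin.castLE_injective _)
    (fun k => Fin.castLE (Nat.pow_le_pow_right two_pos (hb k))) (fun _ => Fin.castLE_injective _)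

lemma HasBitCode.add {a a' : Fin N → ℕ} {b b' : Fin K → ℕ} (h : I.HasBitCode a b)
    (h' : I.HasBitCode a' b') : I.HasBitCode (a + a') (b + b') :=
  (h.prod h').map
    (fun j => (finCongr (pow_add 2 (a j) (a' j))).trans finProdFinEquiv.symm)
    (fun _ => Equiv.injective _)
    (fun k => finProdFinEquiv.trans (finCongr (pow_add 2 (b k) (b' k)).symm))
    (fun _ => Equiv.injective _)

lemma HasBitCode.nsmul {a : Fin N → ℕ} {b : Fin K → ℕ} (h : I.HasBitCode a b) (n : ℕ) :
    I.HasBitCode (n • a) (n • b) := by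
  induction n with
  | zero =>
    refine ⟨fun k _ => ⟨0, by positivity⟩, fun j m m' _ _ => Fin.ext ?_⟩
    have h1 := (m j).isLt
    have h2 := (m' j).isLt
    simp only [zero_smul, Pi.zero_apply, pow_zero] at h1 h2
    omega
  | succ n ih =>
    rw [succ_nsmul, succ_nsmul]
    exact ih.add h

/-- A criterion for the code in which every sender transmits the sum of its messages. -/
lemma hasBitCode_of_parity {a : Fin N → ℕ} {b : Fin K → ℕ}
    (h : ∀ v v' : Fin N → ℕ, (∀ i, v i < 2 ^ a i) → (∀ i, v' i < 2 ^ a i) →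
      (∀ k, (∑ i ∈ I.S k, v i) % 2 ^ b k = (∑ i ∈ I.S k, v' i) % 2 ^ b k) →
      ∀ j, (∀ i ∈ I.A j, v i = v' i) → v j = v' j) : I.HasBitCode a b := by
  refine ⟨fun k m => ⟨(∑ i, (m i : ℕ)) % 2 ^ b k, Nat.mod_lt _ (by positivity)⟩,
    fun j m m' hL hA => Fin.ext ?_⟩
  refine h (fun i => m i) (fun i => m' i) (fun i => (m i).isLt) (fun i => (m' i).isLt)
    (fun k => ?_) j fun i hi => by rw [hA i hi]
  have : (∑ i : {i // i ∈ I.S k}, (m i : ℕ)) % 2 ^ b k =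
      (∑ i : {i // i ∈ I.S k}, (m' i : ℕ)) % 2 ^ b k := congrArg Fin.val (hL k)
  rwa [Finset.sum_coe_sort (I.S k) fun i => (m i : ℕ),
    Finset.sum_coe_sort (I.S k) fun i => (m' i : ℕ)] at this

lemma Code.errorProb_eq_zero {R : Fin N → ℝ} {n : ℕ} (c : I.Code R n)
    (h : ∀ m j, c.estimate m j = m j) : c.errorProb = 0 := by
  have : IsEmpty {m : ∀ j, Msg n (R j) // (fun j => c.estimate m j) ≠ m} :=
    ⟨fun m => m.2 (funext (h m.1))⟩
  rw [Code.errorProb, Nat.card_of_isEmpty, Nat.cast_zero, zero_div]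

lemma HasBitCode.exists_code {R : Fin N → ℝ} {n : ℕ}
    (h : I.HasBitCode (fun j => ⌈(n : ℝ) * R j⌉₊) fun k => ⌊(n : ℝ) * I.C k⌋₊) :
    ∃ c : I.Code R n, c.errorProb = 0 := by
  classical
  obtain ⟨enc, h⟩ := h
  -- The decoder takes any message tuple consistent with the links and its side information; the
  -- zero-error property makes the `j`-th entry independent of this choice.
  refine ⟨⟨enc, fun j y side => if h : ∃ m : ∀ i, Msg n (R i),
      (∀ k, enc k (fun i => m i) = y k) ∧ ∀ i : {i // i ∈ I.A j}, m i = side i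
    then h.choose j else ⟨0, by positivity⟩⟩, Code.errorProb_eq_zero _ fun m j => ?_⟩
  have hex : ∃ m' : ∀ i, Msg n (R i), (∀ k, enc k (fun i => m' i) = enc k fun i => m i) ∧
      ∀ i : {i // i ∈ I.A j}, m' i = m i := ⟨m, fun _ => rfl, fun _ => rfl⟩
  simp only [Code.estimate]
  rw [dif_pos hex]
  exact h j _ _ hex.choose_spec.1 fun i hi => hex.choose_spec.2 ⟨i, hi⟩

lemma achievable_of_eventually {R : Fin N → ℝ} (hR : ∀ j, 0 ≤ R j)
    (h : ∀ᶠ n : ℕ in atTop, ∃ c : I.Code R n, c.errorProb = 0) : I.Achievable R := by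
  classical
  let triv : ∀ n, I.Code R n := fun n =>
    ⟨fun _ _ => ⟨0, by positivity⟩, fun _ _ _ => ⟨0, by positivity⟩⟩
  refine ⟨hR, fun n => if h : ∃ c : I.Code R n, c.errorProb = 0 then h.choose else triv n, ?_⟩
  refine tendsto_const_nhds.congr' ?_
  filter_upwards [h] with n hn
  rw [dif_pos hn, hn.choose_spec]

end IndexProblem

/-! ### Codes for the instance -/

/-- Only the two-link codes are subtle: receiver 0 adds both parities, and everything but message 0
and the known message 3 cancels. In the two codes with `![0, 1, 1, 0, 0]`, receivers 1 and 2 each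
know the other's message. The remaining codes send one bit uncoded. -/
lemma hasBitCode_units :
    fourSenderProblem.HasBitCode ![1, 1, 1, 1, 0] ![1, 1, 0, 0] ∧
    fourSenderProblem.HasBitCode ![0, 1, 1, 0, 0] ![1, 0, 0, 0] ∧
    fourSenderProblem.HasBitCode ![0, 1, 1, 0, 0] ![0, 1, 0, 0] ∧
    fourSenderProblem.HasBitCode ![1, 1, 0, 1, 0] ![0, 0, 1, 1] ∧
    fourSenderProblem.HasBitCode ![1, 0, 0, 0, 0] ![0, 0, 1, 0] ∧
    fourSenderProblem.HasBitCode ![0, 1, 0, 0, 0] ![0, 0, 1, 0] ∧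
    fourSenderProblem.HasBitCode ![0, 1, 0, 0, 0] ![0, 0, 0, 1] ∧
    fourSenderProblem.HasBitCode ![0, 0, 0, 0, 1] ![0, 0, 0, 1] := by
  refine ⟨?_, ?_, ?_, ?_, ?_, ?_, ?_, ?_⟩ <;>
  · refine hasBitCode_of_parity fun v v' hv hv' hL j hA => ?_
    have s1 : ∀ u : Fin 5 → ℕ, ∑ i ∈ {0, 1, 2}, u i = u 0 + u 1 + u 2 := fun u => by
      simp [add_assoc]
    have s2 : ∀ u : Fin 5 → ℕ, ∑ i ∈ {1, 2, 3}, u i = u 1 + u 2 + u 3 := fun u => by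
      simp [add_assoc]
    have s3 : ∀ u : Fin 5 → ℕ, ∑ i ∈ {0, 1}, u i = u 0 + u 1 := fun u => by simp
    have s4 : ∀ u : Fin 5 → ℕ, ∑ i ∈ {1, 3, 4}, u i = u 1 + u 3 + u 4 := fun u => by
      simp [add_assoc]
    simp [Fin.forall_fin_succ, fourSenderProblem, s1, s2, s3, s4] at hv hv' hL
    fin_cases j <;> simp [fourSenderProblem] at hA ⊢ <;> omega

lemma hasBitCode_of_le {a : Fin 5 → ℕ} {n : ℕ} (h0 : a 0 ≤ 2 * n) (h2 : a 2 ≤ 2 * n)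
    (h4 : a 4 ≤ n) (h02 : a 0 + a 2 ≤ 3 * n) (h34 : a 3 + a 4 ≤ 2 * n)
    (h014 : a 0 + a 1 + a 4 ≤ 4 * n) (h134 : a 1 + a 3 + a 4 ≤ 4 * n)
    (h234 : a 2 + a 3 + a 4 ≤ 3 * n) : fourSenderProblem.HasBitCode a fun _ => n := by
  obtain ⟨x, p, q, s, t, hx, hp, hq, hs, ht, hxn, hn, g0, g1, g2, g3, g4⟩ :=
    -- Over the integers the amounts are whole numbers of uses of each code, so no rounding occurs.
    exists_timeSharing (α := ℤ) (R := fun j => a j) (n := n) (by simp) (by omega) (by omega)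
      (by omega) (by omega) (by omega) (by omega) (by omega) (by omega)
  lift x to ℕ using hx
  lift p to ℕ using hp
  lift q to ℕ using hq
  lift s to ℕ using hs
  lift t to ℕ using ht
  obtain ⟨u1, u2, u3, u4, u5, u6, u7, u8⟩ := hasBitCode_units
  refine (((((((u1.nsmul x).add ((u2.add u3).nsmul (n - x))).add (u4.nsmul p)).add
    ((u5.add u8).nsmul q)).add ((u6.add u8).nsmul s))).add ((u6.add u7).nsmul t)).mono ?_ ?_
  · intro j
    fin_cases j <;> simp at g0 g1 g2 g3 g4 ⊢ <;> omega
  · intro k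
    fin_cases k <;> simp <;> omega

lemma achievable_of_mem_fourSenderRegion {R : Fin 5 → ℝ} (hR : R ∈ fourSenderRegion) :
    fourSenderProblem.Achievable R := by
  obtain ⟨hR, h0, h2, h4, h02, h34, h014, h134, h234⟩ := hR
  refine achievable_of_eventually hR ?_
  -- Each ceiling costs less than 1 and each inequality involves at most three rates, so slack 3
  -- suffices.
  have large : ∀ a : ℝ, 0 < a → ∀ᶠ n : ℕ in atTop, 3 < n * a := fun a ha =>
    (tendsto_natCast_atTop_atTop.atTop_mul_const ha).eventually_gt_atTop 3
  filter_upwards [large _ (sub_pos.2 h0), large _ (sub_pos.2 h2), large _ (sub_pos.2 h4),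
    large _ (sub_pos.2 h02), large _ (sub_pos.2 h34), large _ (sub_pos.2 h014),
    large _ (sub_pos.2 h134), large _ (sub_pos.2 h234)] with n l0 l2 l4 l02 l34 l014 l134 l234
  have hc : ∀ j, (⌈(n : ℝ) * R j⌉₊ : ℝ) < n * R j + 1 := fun j =>
    Nat.ceil_lt_add_one (mul_nonneg n.cast_nonneg (hR j))
  have c0 := hc 0
  have c1 := hc 1
  have c2 := hc 2
  have c3 := hc 3
  have c4 := hc 4
  refine HasBitCode.exists_code ((hasBitCode_of_le (n := n) ?_ ?_ ?_ ?_ ?_ ?_ ?_ ?_).mono le_rfl ?_)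
  · rw [← Nat.cast_le (α := ℝ)]; push_cast; linarith
  · rw [← Nat.cast_le (α := ℝ)]; push_cast; linarith
  · rw [← Nat.cast_le (α := ℝ)]; linarith
  · rw [← Nat.cast_le (α := ℝ)]; push_cast; linarith
  · rw [← Nat.cast_le (α := ℝ)]; push_cast; linarith
  · rw [← Nat.cast_le (α := ℝ)]; push_cast; linarith
  · rw [← Nat.cast_le (α := ℝ)]; push_cast; linarith
  · rw [← Nat.cast_le (α := ℝ)]; push_cast; linarith
  · intro k
    simp [fourSenderProblem_C]

namespace IndexProblem

variable {N K : ℕ} {I : IndexProblem N K}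

/-! ### The MAIS outer bound for codes -/

/-- Correctly decoded message tuples are determined by the messages outside an acyclic set and
the links that carry information about this set. -/
lemma Code.eq_of_correct {R : Fin N → ℝ} {n : ℕ} (c : I.Code R n) {T : Finset (Fin N)}
    (hT : I.InducedAcyclic T) {m m' : ∀ j, Msg n (R j)} (hm : ∀ j, c.estimate m j = m j)
    (hm' : ∀ j, c.estimate m' j = m' j) (hout : ∀ j ∉ T, m j = m' j)
    (henc : ∀ k, (I.S k ∩ T).Nonempty → c.enc k (fun i => m i) = c.enc k fun i => m' i) :
    m = m' := by
  have hlink : ∀ k, c.enc k (fun i => m i) = c.enc k fun i => m' i := by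
    intro k
    by_cases h : (I.S k ∩ T).Nonempty
    · exact henc k h
    · congr 1
      funext i
      exact hout i fun hi => h ⟨i, Finset.mem_inter.2 ⟨i.2, hi⟩⟩
  by_contra hne
  obtain ⟨j, hj⟩ := Function.ne_iff.1 hne
  -- The messages where the tuples differ form an acyclic set. Its sink sees equal links and equal
  -- side information, so it decodes equal messages, a contradiction.
  have hsub : ({j ∈ T | m j ≠ m' j} : Finset (Fin N)) ⊆ T := Finset.filter_subset _ _
  obtain ⟨i, hi, hsink⟩ := (hT.mono hsub).exists_sink
    ⟨j, Finset.mem_filter.2 ⟨by_contra fun h => hj (hout j h), hj⟩⟩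
  refine (Finset.mem_filter.1 hi).2 ?_
  rw [← hm i, ← hm' i, Code.estimate, Code.estimate, funext hlink]
  congr 1
  funext l
  by_contra hl
  exact hsink l (Finset.mem_filter.2 ⟨by_contra fun h => hl (hout l h), hl⟩) l.2

lemma card_msgs {R : Fin N → ℝ} {n : ℕ} :
    Nat.card (∀ j, Msg n (R j)) = 2 ^ ∑ j, ⌈(n : ℝ) * R j⌉₊ := by
  simp [Finset.prod_pow_eq_pow_sum]

lemma Code.card_correct_le {R : Fin N → ℝ} {n : ℕ} (c : I.Code R n) {T : Finset (Fin N)}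
    (hT : I.InducedAcyclic T) :
    Nat.card {m : ∀ j, Msg n (R j) // (fun j => c.estimate m j) = m} ≤
      2 ^ (∑ j ∈ Tᶜ, ⌈(n : ℝ) * R j⌉₊ + ∑ k with (I.S k ∩ T).Nonempty, ⌊(n : ℝ) * I.C k⌋₊) := by
  let f : {m : ∀ j, Msg n (R j) // (fun j => c.estimate m j) = m} →
      (∀ j : {j // j ∈ Tᶜ}, Msg n (R j)) ×
        (∀ k : {k // k ∈ ({k | (I.S k ∩ T).Nonempty} : Finset (Fin K))}, Link n (I.C k)) :=
    fun m => (fun j => m.1 j, fun k => c.enc k fun i => m.1 i)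
  have hf : Function.Injective f := by
    intro m m' h
    refine Subtype.ext (c.eq_of_correct hT (congrFun m.2) (congrFun m'.2) ?_ ?_)
    · intro j hj
      exact congrFun (congrArg Prod.fst h) ⟨j, Finset.mem_compl.2 hj⟩
    · intro k hk
      exact congrFun (congrArg Prod.snd h) ⟨k, by simpa using hk⟩
  refine (Nat.card_le_card_of_injective f hf).trans_eq ?_
  rw [Nat.card_prod, Nat.card_pi, Nat.card_pi, pow_add]
  simp only [Nat.card_eq_fintype_card, Fintype.card_fin, Finset.prod_pow_eq_pow_sum]
  rw [Finset.sum_coe_sort Tᶜ fun j => ⌈(n : ℝ) * R j⌉₊,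
    Finset.sum_coe_sort _ fun k => ⌊(n : ℝ) * I.C k⌋₊]

/-- More than half of all message tuples are decoded correctly; comparing with the count in
`Code.card_correct_le` loses a factor 2, which is the extra bit. -/
lemma Code.sum_ceil_le {R : Fin N → ℝ} {n : ℕ} (c : I.Code R n) (hc : c.errorProb < 1 / 2)
    {T : Finset (Fin N)} (hT : I.InducedAcyclic T) :
    ∑ j ∈ T, ⌈(n : ℝ) * R j⌉₊ ≤
      1 + ∑ k with (I.S k ∩ T).Nonempty, ⌊(n : ℝ) * I.C k⌋₊ := by
  have hsplit : Nat.card {m : ∀ j, Msg n (R j) // (fun j => c.estimate m j) = m} +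
      Nat.card {m : ∀ j, Msg n (R j) // (fun j => c.estimate m j) ≠ m} =
        Nat.card (∀ j, Msg n (R j)) := by
    classical
    rw [← Nat.card_sum]
    exact Nat.card_congr (Equiv.sumCompl _)
  have hcard := c.card_correct_le hT
  rw [Code.errorProb, div_lt_iff₀ (by rw [card_msgs]; positivity)] at hc
  have h2 : 2 ^ ∑ j, ⌈(n : ℝ) * R j⌉₊ <
      2 * 2 ^ (∑ j ∈ Tᶜ, ⌈(n : ℝ) * R j⌉₊ +
        ∑ k with (I.S k ∩ T).Nonempty, ⌊(n : ℝ) * I.C k⌋₊) := by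
    rw [← card_msgs]
    have : Nat.card {m : ∀ j, Msg n (R j) // (fun j => c.estimate m j) ≠ m} * 2 <
        Nat.card (∀ j, Msg n (R j)) := by
      rw [← Nat.cast_lt (α := ℝ)]
      push_cast
      linarith
    omega
  rw [← pow_succ', Nat.pow_lt_pow_iff_right one_lt_two,
    ← Finset.sum_add_sum_compl T] at h2
  omega

lemma Achievable.mem_maisRegion {R : Fin N → ℝ} (h : I.Achievable R) : R ∈ I.maisRegion := by
  obtain ⟨hR, c, hc⟩ := h
  refine ⟨hR, fun T hT => ?_⟩
  by_contra! hlt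
  have h1 := hc.eventually_lt_const (show (0 : ℝ) < 1 / 2 by norm_num)
  -- A violated inequality has a gap growing linearly in `n`, which eventually exceeds the one spare
  -- bit.
  have h2 := (tendsto_natCast_atTop_atTop.atTop_mul_const (sub_pos.2 hlt)).eventually_gt_atTop
    (1 : ℝ)
  obtain ⟨n, hn1, hn2⟩ := (h1.and h2).exists
  have h3 : (∑ j ∈ T, (⌈(n : ℝ) * R j⌉₊ : ℝ)) ≤
      1 + ∑ k with (I.S k ∩ T).Nonempty, (⌊(n : ℝ) * I.C k⌋₊ : ℝ) := by
    exact_mod_cast (c n).sum_ceil_le hn1 hT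
  have h4 : ∑ j ∈ T, (n : ℝ) * R j ≤ ∑ j ∈ T, (⌈(n : ℝ) * R j⌉₊ : ℝ) :=
    Finset.sum_le_sum fun j _ => Nat.le_ceil _
  have h5 : ∑ k with (I.S k ∩ T).Nonempty, (⌊(n : ℝ) * I.C k⌋₊ : ℝ) ≤
      ∑ k with (I.S k ∩ T).Nonempty, (n : ℝ) * I.C k :=
    Finset.sum_le_sum fun k _ => Nat.floor_le (mul_nonneg n.cast_nonneg (I.C_pos k).le)
  rw [← Finset.mul_sum] at h4 h5
  linarith

lemma isClosed_maisRegion : IsClosed I.maisRegion := by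
  have : I.maisRegion = (⋂ j, {R | 0 ≤ R j}) ∩ ⋂ (T : Finset (Fin N)) (_ : I.InducedAcyclic T),
      {R | ∑ j ∈ T, R j ≤ ∑ k with (I.S k ∩ T).Nonempty, I.C k} := by
    ext R
    simp [maisRegion]
  rw [this]
  refine (isClosed_iInter fun j => isClosed_le continuous_const (continuous_apply j)).inter
    (isClosed_iInter fun T => isClosed_iInter fun _ => isClosed_le ?_ continuous_const)
  exact continuous_finsetSum _ fun j _ => continuous_apply j

end IndexProblem

/-! ### Closures, the capacity region and the separating tuples -/

lemma maisRegion_subset_closure : fourSenderProblem.maisRegion ⊆ closure fourSenderRegion := by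
  rintro R ⟨hR, hmais⟩
  have h0 := hmais {0} (inducedAcyclic_of_mem_boundingSets (by decide))
  have h2 := hmais {2} (inducedAcyclic_of_mem_boundingSets (by decide))
  have h4 := hmais {4} (inducedAcyclic_of_mem_boundingSets (by decide))
  have h02 := hmais {0, 2} (inducedAcyclic_of_mem_boundingSets (by decide))
  have h34 := hmais {3, 4} (inducedAcyclic_of_mem_boundingSets (by decide))
  have h014 := hmais {0, 1, 4} (inducedAcyclic_of_mem_boundingSets (by decide))
  have h134 := hmais {1, 3, 4} (inducedAcyclic_of_mem_boundingSets (by decide))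
  have h234 := hmais {2, 3, 4} (inducedAcyclic_of_mem_boundingSets (by decide))
  have hcard : ∀ T : Finset (Fin 5), ∑ k with (fourSenderProblem.S k ∩ T).Nonempty,
      fourSenderProblem.C k = touching Finset.univ T := fun T => by
    simp [fourSenderProblem_C, touching]
  have t0 : touching Finset.univ {0} = 2 := by decide
  have t2 : touching Finset.univ {2} = 2 := by decide
  have t4 : touching Finset.univ {4} = 1 := by decide
  have t02 : touching Finset.univ {0, 2} = 3 := by decide
  have t34 : touching Finset.univ {3, 4} = 2 := by decide
  have t014 : touching Finset.univ {0, 1, 4} = 4 := by decide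
  have t134 : touching Finset.univ {1, 3, 4} = 4 := by decide
  have t234 : touching Finset.univ {2, 3, 4} = 3 := by decide
  rw [hcard] at h0 h2 h4 h02 h34 h014 h134 h234
  simp [t0, t2, t4, t02, t34, t014, t134, t234] at h0 h2 h4 h02 h34 h014 h134 h234
  -- All eight bounds are positive, so scaling by `a < 1` makes them strict.
  have hlim : Tendsto (fun a : ℝ => a • R) (𝓝[<] 1) (𝓝 R) := by
    have : Tendsto (fun a : ℝ => a • R) (𝓝 1) (𝓝 ((1 : ℝ) • R)) :=
      tendsto_id.smul_const R
    rw [one_smul] at this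
    exact this.mono_left nhdsWithin_le_nhds
  refine mem_closure_of_tendsto hlim ?_
  filter_upwards [self_mem_nhdsWithin, nhdsWithin_le_nhds (Ioi_mem_nhds (zero_lt_one (α := ℝ)))]
    with a ha1 ha0
  rw [Set.mem_Iio] at ha1
  rw [Set.mem_Ioi] at ha0
  have key : ∀ s b : ℝ, 0 < b → s ≤ b → a * s < b := by
    intro s b hb hs
    calc a * s ≤ a * b := mul_le_mul_of_nonneg_left hs ha0.le
      _ < b := mul_lt_of_lt_one_left hb ha1
  refine ⟨fun j => mul_nonneg ha0.le (hR j), ?_⟩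
  simp only [Pi.smul_apply, smul_eq_mul, ← mul_add]
  refine ⟨key _ _ ?_ h0, key _ _ ?_ h2, key _ _ ?_ h4, key _ _ ?_ h02, key _ _ ?_ h34,
    key _ _ ?_ ?_, key _ _ ?_ ?_, key _ _ ?_ ?_⟩ <;> linarith

lemma closure_fourSenderRegion : closure fourSenderRegion = fourSenderProblem.maisRegion :=
  (closure_minimal (fun _ hR => (achievable_of_mem_fourSenderRegion hR).mem_maisRegion)
    isClosed_maisRegion).antisymm maisRegion_subset_closure

lemma capacityRegion_fourSenderProblem :
    fourSenderProblem.capacityRegion = closure fourSenderRegion := by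
  refine (closure_minimal ?_ isClosed_closure).antisymm
    (closure_mono fun _ hR => achievable_of_mem_fourSenderRegion hR)
  exact fun R hR => maisRegion_subset_closure (Achievable.mem_maisRegion hR)

lemma cccRegion_pairPartition :
    fourSenderProblem.cccRegion pairPartition.parts = fourSenderRegion :=
  (cccRegion_subset_fourSenderRegion _).antisymm fourSenderRegion_subset_cccRegion

lemma RCS_eq_fourSenderRegion : fourSenderProblem.RCS = fourSenderRegion := by
  refine RCS_subset_fourSenderRegion.antisymm ?_
  rw [← cccRegion_pairPartition]
  exact (Set.subset_iUnion (fun Pi : Finpartition (Finset.univ : Finset (Fin 4)) =>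
    fourSenderProblem.cccRegion Pi.parts) pairPartition).trans (subset_convexHull ℝ _)

lemma closure_RC_subset :
    closure fourSenderProblem.RC ⊆ {R | R 0 + R 1 + R 2 + R 3 ≤ 6} := by
  refine closure_minimal (fun R hR => (RC_sum_lt hR).le) ?_
  exact isClosed_le (by fun_prop) continuous_const

/-- A tuple of the explicit region beyond the reach of a single group. -/
lemma exists_mem_fourSenderRegion_sum :
    ∃ R ∈ fourSenderRegion, 6 < R 0 + R 1 + R 2 + R 3 := by
  -- Close to the boundary point `(1, 3, 2, 1, 0)`, where the sum is 7.
  refine ⟨![9 / 10, 29 / 10, 19 / 10, 9 / 10, 0], ⟨?_, ?_⟩, ?_⟩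
  · intro j
    fin_cases j <;> norm_num
  · simp
    norm_num
  · simp
    norm_num

/-- A tuple of the explicit region beyond the reach of distributed composite coding. -/
lemma exists_mem_fourSenderRegion_weighted_sum :
    ∃ R ∈ fourSenderRegion, 17 < 3 * R 0 + 2 * R 1 + 2 * R 2 + 3 * R 3 := by
  -- Close to the boundary point `(2, 2, 1, 2, 0)`, where the weighted sum is 18.
  refine ⟨![39 / 20, 39 / 20, 19 / 20, 39 / 20, 0], ⟨?_, ?_⟩, ?_⟩
  · intro j
    fin_cases j <;> norm_num
  · simp
    norm_num
  · simp
    norm_num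

theorem mainTheorem5 :
    -- the partition {{1,2},{3,4}} attains the explicit region, and no partition does better
    fourSenderProblem.cccRegion pairPartition.parts = fourSenderRegion ∧
    fourSenderProblem.RCS = fourSenderRegion ∧
    -- the region is achievable, its closure is the MAIS outer bound and the capacity region
    (∀ R ∈ fourSenderRegion, fourSenderProblem.Achievable R) ∧
    closure fourSenderRegion = fourSenderProblem.maisRegion ∧
    fourSenderProblem.capacityRegion = closure fourSenderRegion ∧
    -- one single group is strictly worse and does not attain capacity
    fourSenderProblem.RC ⊂ fourSenderProblem.RCS ∧
    closure fourSenderProblem.RC ≠ fourSenderProblem.capacityRegion ∧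
    -- partitioned DCC is strictly worse
    fourSenderProblem.RS ⊂ fourSenderProblem.RCS := by
  obtain ⟨R₁, hR₁, h₁⟩ := exists_mem_fourSenderRegion_sum
  obtain ⟨R₂, hR₂, h₂⟩ := exists_mem_fourSenderRegion_weighted_sum
  refine ⟨cccRegion_pairPartition, RCS_eq_fourSenderRegion,
    fun R hR => achievable_of_mem_fourSenderRegion hR, closure_fourSenderRegion,
    capacityRegion_fourSenderProblem, ?_, ?_, ?_⟩
  · refine (Set.ssubset_iff_of_subset RC_subset_RCS).2 ⟨R₁, ?_, fun h => ?_⟩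
    · rwa [RCS_eq_fourSenderRegion]
    · exact h₁.not_gt (RC_sum_lt h)
  · intro h
    have hmem : R₁ ∈ closure fourSenderProblem.RC := by
      rw [h, capacityRegion_fourSenderProblem]
      exact subset_closure hR₁
    exact h₁.not_ge (closure_RC_subset hmem)
  · refine (Set.ssubset_iff_of_subset RS_subset_RCS).2 ⟨R₂, ?_, fun h => ?_⟩
    · rwa [RCS_eq_fourSenderRegion]
    · exact h₂.not_ge (RS_sum_le h)
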